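/- \textbf{Concurrent mean-payoff games.} A concurrent game has a finite set $S$ of states, a finite set of moves, non-empty sets $\Gamma_1(s),\Gamma_2(s)$ of moves available to Players 1 and 2 at $s$, and a transition law $\delta(s,a,b)$ on $S$. A strategy maps every finite history (past states and pairs of moves) and the current state to a probability distribution on the available moves; in each round the two moves are drawn independently. $\mathbb{E}_s^{\sigma,\tau}$ is the expectation over plays $(s_0,a_0,b_0),(s_1,a_1,b_1),\dots$ from $s_0=s$ when Player 1 uses $\sigma$ and Player 2 uses $\tau$. For a reward $R(s,a,b)$ let $\mathrm{LimInfAvg}_R$ and $\mathrm{LimSupAvg}_R$ be the lower and upper limits, as $T\to\infty$, of $\frac1T\sum_{k<T}R(s_k,a_k,b_k)$. When Player 1 maximizes $R$, the game has value $v$ at $s$ if $\sup_\sigma\inf_\tau\mathbb{E}_s^{\sigma,\tau}[\mathrm{LimInfAvg}_R]=v=\inf_\tau\sup_\sigma\mathbb{E}_s^{\sigma,\tau}[\mathrm{LimSupAvg}_R]$; when Player 2 maximizes $R$, the roles of $\sigma$ and $\tau$ are exchanged. The game is \emph{ergodic} if for all states $s,t$ and all strategy profiles, the play from $s$ visits $t$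 infinitely often with probability $1$. \textbf{The block-withholding game.} Let $n\ge1$ and $\epsilon=\frac1{2n+1}$. The states are the pairs $(i_1,i_2)\in\{1,\dots,n\}^2$: pool $A$ (Player 1) owns the fraction $\alpha=i_1\epsilon$ of the total computing power, pool $B$ (Player 2) owns $\beta=i_2\epsilon$, and the remaining miners $C$ own the rest. At $(i_1,i_2)$ pool $A$ chooses $i\in\{0,\dots,i_1-1\}$ and uses the power $\alpha'=i\epsilon$ to attack $B$; simultaneously $B$ chooses $j\in\{0,\dots,i_2-1\}$ and uses $\beta'=j\epsilon$ to attack $A$. The revenues $r_A,r_B$ and the attractiveness levels $attr_A,attr_B$ are the unique solution of $$attr_A=\frac{r_A}{\alpha+\beta'},\quad attr_B=\frac{r_B}{\beta+\alpha'},\quad r_A=(\alpha-\alpha')+\alpha'\,attr_B,\quad r_B=(\beta-\beta')+\beta'\,attr_A ,$$ and $r_C=1-r_A-r_B$. Then each pool changes its size: a pool whose attractiveness is at least that of the other pool (so, in a tie, each of them) gains one unit $\epsilon$ with probability $\frac23$, keeps its size with probability $\frac16$ and loses one unit with probability $\frac16$; a pool that is strictly less attractive loses one unit with probability $\frac23$,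 keeps its size with probability $\frac16$ and gains one unit with probability $\frac16$. Given the state and the moves, the changes of the two pools are independent; a gain at size $n$ and a loss at size $1$ leave the size unchanged. \textbf{Theorem.} For every $n\ge1$ the block-withholding game is ergodic, and there is a number $v$ such that (a) at every state, $v$ is the value of the game in which $A$ maximizes the mean payoff of $r_A$; (b) at every state, $v$ is also the value of the game in which $B$ maximizes the mean payoff of $r_B$; (c) $B$ can ensure a revenue of at least $v$ on average per round against any behavior of $A$: $B$ has a strategy $\tau$ such that $\mathbb{E}_s^{\sigma,\tau}[\mathrm{LimInfAvg}_{r_B}]\ge v$ for every strategy $\sigma$ of $A$ and every initial state $s$. -/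

import Mathlib

open MeasureTheory ProbabilityTheory Filter

noncomputable section

/-! ### Concurrent stochastic games with mean-payoff objectives -/

/-- A concurrent stochastic game structure with states `S` and actions `Act`. At a state `s` the
players simultaneously choose moves in `moves₁ s` and `moves₂ s`, and the successor state is drawn
from `trans s a b`. -/
structure ConcurrentGame (S Act : Type) where
  moves₁ : S → Finset Act
  moves₂ : S → Finset Act
  moves₁_nonempty : ∀ s, (moves₁ s).Nonempty
  moves₂_nonempty : ∀ s, (moves₂ s).Nonempty
  trans : S → Act → Act → PMF S

/-- A strategy of a player whose available moves are given by `moves`: it maps every finite history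
of (state, move of Player 1, move of Player 2) triples, oldest first, together with the current
state, to a probability distribution on the available moves. -/
structure Strategy {S Act : Type} (moves : S → Finset Act) where
  dist : List (S × Act × Act) → S → PMF Act
  support_subset : ∀ h s, ∀ a ∈ (dist h s).support, a ∈ moves s

namespace ConcurrentGame

variable {S Act : Type}

abbrev Strategy₁ (G : ConcurrentGame S Act) : Type := Strategy G.moves₁

abbrev Strategy₂ (G : ConcurrentGame S Act) : Type := Strategy G.moves₂

/-- The law of the triple (state, move of Player 1, move of Player 2) of a round that is played in
state `s` after the history `h`: the two moves are chosen independently. -/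
def roundLaw (G : ConcurrentGame S Act) (σ : G.Strategy₁) (τ : G.Strategy₂)
    (h : List (S × Act × Act)) (s : S) : PMF (S × Act × Act) :=
  (σ.dist h s).bind fun a => (τ.dist h s).map fun b => (s, a, b)

/-- The law of the next round, given a nonempty history `x 0, …, x k`. -/
def nextLaw (G : ConcurrentGame S Act) (σ : G.Strategy₁) (τ : G.Strategy₂) (k : ℕ)
    (x : (i : Finset.Iic k) → S × Act × Act) : PMF (S × Act × Act) :=
  let last := x ⟨k, Finset.mem_Iic.2 le_rfl⟩
  let hist := List.ofFn fun i : Fin (k + 1) =>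
    x ⟨(i : ℕ), Finset.mem_Iic.2 (Nat.lt_succ_iff.1 i.isLt)⟩
  (G.trans last.1 last.2.1 last.2.2).bind (G.roundLaw σ τ hist)

variable [Finite S] [Finite Act]
variable [MeasurableSpace S] [DiscreteMeasurableSpace S]
variable [MeasurableSpace Act] [DiscreteMeasurableSpace Act]

/-- `nextLaw` as a Markov kernel; measurability is automatic on finite spaces. -/
def nextKernel (G : ConcurrentGame S Act) (σ : G.Strategy₁) (τ : G.Strategy₂) (k : ℕ) :
    Kernel ((i : Finset.Iic k) → S × Act × Act) (S × Act × Act) where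
  toFun x := (G.nextLaw σ τ k x).toMeasure
  measurable' := measurable_of_finite _

instance (G : ConcurrentGame S Act) (σ : G.Strategy₁) (τ : G.Strategy₂) (k : ℕ) :
    IsMarkovKernel (G.nextKernel σ τ k) :=
  ⟨fun x => PMF.toMeasure.isProbabilityMeasure (G.nextLaw σ τ k x)⟩

/-- The probability measure on plays when the game starts in `s` and is played according to the
strategy profile `(σ, τ)`. The `k`-th entry of a play is the triple of the `k`-th state and the two
moves chosen there. -/
def playMeasure (G : ConcurrentGame S Act) (σ : G.Strategy₁) (τ : G.Strategy₂) (s : S) :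
    Measure (ℕ → S × Act × Act) :=
  Kernel.trajMeasure (X := fun _ => S × Act × Act) (G.roundLaw σ τ [] s).toMeasure
    (G.nextKernel σ τ)

/-- The game is ergodic: from every state, whatever the strategy profile, every state is visited
infinitely often with probability one. -/
def Ergodic (G : ConcurrentGame S Act) : Prop :=
  ∀ (s t : S) (σ : G.Strategy₁) (τ : G.Strategy₂),
    ∀ᵐ ω ∂(G.playMeasure σ τ s), ∃ᶠ k in atTop, (ω k).1 = t

/-- The average reward of a play over its first `T` rounds. -/
def avg (r : S → Act → Act → ℝ) (ω : ℕ → S × Act × Act) (T : ℕ) : ℝ :=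
  (∑ k ∈ Finset.range T, r (ω k).1 (ω k).2.1 (ω k).2.2) / T

/-- The limit-inferior average reward of a play. As `S` and `Act` are finite in all that follows,
the averages are bounded. -/
def limInfAvg (r : S → Act → Act → ℝ) (ω : ℕ → S × Act × Act) : ℝ :=
  liminf (avg r ω) atTop

/-- The limit-superior average reward of a play. -/
def limSupAvg (r : S → Act → Act → ℝ) (ω : ℕ → S × Act × Act) : ℝ :=
  limsup (avg r ω) atTop

/-- The expectation of the limit-inferior average. -/
def expLimInf (G : ConcurrentGame S Act) (r : S → Act → Act → ℝ)
    (σ : G.Strategy₁) (τ : G.Strategy₂) (s : S) : ℝ :=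
  ∫ ω, limInfAvg r ω ∂(G.playMeasure σ τ s)

/-- The expectation of the limit-superior average. -/
def expLimSup (G : ConcurrentGame S Act) (r : S → Act → Act → ℝ)
    (σ : G.Strategy₁) (τ : G.Strategy₂) (s : S) : ℝ :=
  ∫ ω, limSupAvg r ω ∂(G.playMeasure σ τ s)

/-- `v` is the value at `s` of the zero-sum game in which Player 1 maximizes the mean payoff of
`r`: the lower and the upper value are both `v`. -/
def HasValue₁ (G : ConcurrentGame S Act) (r : S → Act → Act → ℝ) (s : S) (v : ℝ) : Prop :=
  (⨆ σ : G.Strategy₁, ⨅ τ : G.Strategy₂, G.expLimInf r σ τ s) = v ∧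
  (⨅ τ : G.Strategy₂, ⨆ σ : G.Strategy₁, G.expLimSup r σ τ s) = v

/-- `v` is the value at `s` of the zero-sum game in which Player 2 maximizes the mean payoff of
`r`: the lower and the upper value are both `v`. -/
def HasValue₂ (G : ConcurrentGame S Act) (r : S → Act → Act → ℝ) (s : S) (v : ℝ) : Prop :=
  (⨆ τ : G.Strategy₂, ⨅ σ : G.Strategy₁, G.expLimInf r σ τ s) = v ∧
  (⨅ σ : G.Strategy₁, ⨆ τ : G.Strategy₂, G.expLimSup r σ τ s) = v

end ConcurrentGame

/-! ### Revenues of two pools that attack each other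

Pool `A` owns the fraction `α` of the total computing power and uses `α'` of it to infiltrate
pool `B`; pool `B` owns `β` and uses `β'` of it to infiltrate `A`. -/

/-- The attractiveness of `A`. -/
def attrA (α β α' β' : ℝ) : ℝ :=
  ((α - α') * (β + α') + α' * (β - β')) / ((α + β') * (β + α') - α' * β')

/-- The attractiveness of `B`. -/
def attrB (α β α' β' : ℝ) : ℝ :=
  ((β - β') * (α + β') + β' * (α - α')) / ((α + β') * (β + α') - α' * β')

/-- The revenue of `A`: own mining plus the infiltrators' share of the revenue of `B`. The total
revenue is normalized to `1`, what is left by the two pools being the revenue of the others. -/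
def revA (α β α' β' : ℝ) : ℝ := (α - α') + α' * attrB α β α' β'

/-- The revenue of `B`: own mining plus the infiltrators' share of the revenue of `A`. -/
def revB (α β α' β' : ℝ) : ℝ := (β - β') + β' * attrA α β α' β'

/-- Revenues and attractiveness levels are the unique solution of the defining linear system. -/
theorem revenue_system {α β α' β' : ℝ} (hα : 0 < α) (hβ : 0 < β) (hα' : 0 ≤ α') (hβ' : 0 ≤ β')
    (rA rB aA aB : ℝ) :
    (aB = rB / (β + α') ∧ aA = rA / (α + β') ∧
      rA = (α - α') + α' * aB ∧ rB = (β - β') + β' * aA) ↔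
    (rA = revA α β α' β' ∧ rB = revB α β α' β' ∧
      aA = attrA α β α' β' ∧ aB = attrB α β α' β') := by
  have h1 : β + α' ≠ 0 := by positivity
  have h2 : α + β' ≠ 0 := by positivity
  have h3 : (α + β') * (β + α') - α' * β' ≠ 0 := by
    have : (α + β') * (β + α') - α' * β' = α * β + α * α' + β * β' := by ring
    rw [this]
    positivity
  unfold revA revB
  constructor
  · rintro ⟨e1, e2, e3, e4⟩
    rw [eq_div_iff h1, e4] at e1
    rw [eq_div_iff h2, e3] at e2
    have hA : aA = attrA α β α' β' := by
      unfold attrA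
      rw [eq_div_iff h3]
      linear_combination (β + α') * e2 + α' * e1
    have hB : aB = attrB α β α' β' := by
      unfold attrB
      rw [eq_div_iff h3]
      linear_combination (α + β') * e1 + β' * e2
    exact ⟨by rw [e3, hB], by rw [e4, hA], hA, hB⟩
  · rintro ⟨rfl, rfl, rfl, rfl⟩
    refine ⟨?_, ?_, rfl, rfl⟩
    · rw [eq_div_iff h1]
      have e := div_mul_cancel₀ ((β - β') * (α + β') + β' * (α - α')) h3
      have e' := div_mul_cancel₀ ((α - α') * (β + α') + α' * (β - β')) h3
      unfold attrA attrB
      apply mul_right_cancel₀ h3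
      linear_combination (β + α') * e - β' * e'
    · rw [eq_div_iff h2]
      have e := div_mul_cancel₀ ((β - β') * (α + β') + β' * (α - α')) h3
      have e' := div_mul_cancel₀ ((α - α') * (β + α') + α' * (β - β')) h3
      unfold attrA attrB
      apply mul_right_cancel₀ h3
      linear_combination (α + β') * e' - α' * e

/-! ### The block-withholding game -/

/-- The change of the size of a pool in one round: `1` is a gain of one unit, `0` no change and
`-1` a loss of one unit; `best` says whether the pool is a most attractive one. -/
def changeLaw (best : Prop) [Decidable best] : PMF SignType :=
  PMF.ofFintype
    (fun c => if c = 0 then 1 / 6 else if c = (if best then 1 else -1) then 2 / 3 else 1 / 6)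
    (by
      have key : (1 / 6 : ENNReal) + (1 / 6 + 2 / 3) = 1 := by
        rw [← ENNReal.toReal_eq_one_iff, ENNReal.toReal_add, ENNReal.toReal_add] <;> norm_num
        all_goals simp [ENNReal.div_eq_top]
      have huniv : (Finset.univ : Finset SignType) = {0, -1, 1} := by decide
      rw [huniv]
      by_cases h : best
      · simpa [h] using key
      · simpa [h, add_comm] using key)

/-- Apply a change to a pool size; the sizes `1, …, n` are represented by `Fin n`, the element `i`
standing for the size `i + 1`. A gain at the maximal size and a loss at the minimal size have no
effect. -/
def resize {n : ℕ} (i : Fin n) : SignType → Fin n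
  | .pos => ⟨min (i + 1) (n - 1), by have := i.isLt; omega⟩
  | .zero => i
  | .neg => ⟨i - 1, by have := i.isLt; omega⟩

/-- The fraction of the total computing power made up by `k` units. -/
def power (n k : ℕ) : ℝ := k / (2 * n + 1)

/-- A pair `(i, j)` represents the state where `A` owns `i + 1` units and `B` owns `j + 1` units.
The move `a` of a pool is to attack the other pool with `a` units. -/
abbrev PoolState (n : ℕ) : Type := Fin n × Fin n

/-- Evaluate a function of `α β α' β'` at a state and a pair of moves. -/
def atMoves {n : ℕ} (f : ℝ → ℝ → ℝ → ℝ → ℝ) (s : PoolState n) (a b : Fin n) : ℝ :=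
  f (power n (s.1 + 1)) (power n (s.2 + 1)) (power n a) (power n b)

/-- The revenue of `A` per round. -/
def rewardA {n : ℕ} : PoolState n → Fin n → Fin n → ℝ := atMoves revA

/-- The revenue of `B` per round. -/
def rewardB {n : ℕ} : PoolState n → Fin n → Fin n → ℝ := atMoves revB

/-- The block-withholding game: Player 1 is the manager of pool `A`, Player 2 that of pool `B`. A
pool attacks with fewer units than it owns, and the sizes of the two pools change independently
given the state and the moves. -/
def bwGame (n : ℕ) : ConcurrentGame (PoolState n) (Fin n) where
  moves₁ s := Finset.univ.filter fun a => (a : ℕ) < s.1 + 1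
  moves₂ s := Finset.univ.filter fun b => (b : ℕ) < s.2 + 1
  moves₁_nonempty s := ⟨s.1, by simp⟩
  moves₂_nonempty s := ⟨s.2, by simp⟩
  trans s a b :=
    (changeLaw (atMoves attrB s a b ≤ atMoves attrA s a b)).bind fun c =>
      (changeLaw (atMoves attrA s a b ≤ atMoves attrB s a b)).map fun d =>
        (resize s.1 c, resize s.2 d)

end

/-! Whatever the moves, each pool gains, keeps or loses a unit with probability at least 1/6 each,
independently of the other pool. So from any state, with probability at least 1/36, the play gets
one step closer to a given target `t`. An exponential function of the distance to `t` is therefore a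
Lyapunov function whose mean falls by at least 1 per round off `t` (`isLyapunov_bwGame`). It is used
twice.

Recurrence: a play that stopped visiting `t` would violate the law of large numbers for the Lyapunov
function (`IsLyapunov.ae_frequently_eq`).

Value: the Lyapunov function bounds the differences of discounted values between states uniformly in
the discount factor, so letting the factor tend to 1 yields a constant `v` and a potential `h` such
that `v + h s` is the value of the matrix game `r s a b + E[h]` at every `s`
(`IsLyapunov.exists_bellman`). Playing optimally in these matrix games is a stationary strategy. The
potential telescopes along a play and the random deviations average out, so each player secures `v`
almost surely against any behavior; this saddle point gives the value.

Exchanging the two pools preserves the dynamics and exchanges the revenues. Hence `v` and the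
swapped potential solve the equation for `B`, which gives (b) with the same `v`, and the optimal
strategy of `B` gives (c). -/

noncomputable section

/-! ### A strong law of large numbers for bounded martingale differences -/

-- Between consecutive squares there are only O(m) bounded terms, negligible against m², so
-- convergence of the averages along the squares suffices.
open Topology in
theorem tendsto_div_of_tendsto_div_sq {y : ℕ → ℝ} {C : ℝ} (hy : ∀ k, |y k| ≤ C)
    (h : Tendsto (fun n : ℕ => (∑ k ∈ Finset.range ((n + 1) ^ 2), y k) / ((n : ℝ) + 1) ^ 2) atTop
      (𝓝 0)) :
    Tendsto (fun T : ℕ => (∑ k ∈ Finset.range T, y k) / T) atTop (𝓝 0) := by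
  have hC : 0 ≤ C := (abs_nonneg _).trans (hy 0)
  have hsqrt : Tendsto (fun T : ℕ => Nat.sqrt T - 1) atTop atTop := by
    refine tendsto_atTop.2 fun b => ?_
    filter_upwards [eventually_ge_atTop ((b + 1) ^ 2)] with T hT
    have := Nat.le_sqrt'.2 hT
    omega
  have hb : Tendsto (fun n : ℕ => |(∑ k ∈ Finset.range ((n + 1) ^ 2), y k) / ((n : ℝ) + 1) ^ 2| +
      2 * C * (1 / ((n : ℝ) + 1))) atTop (𝓝 0) := by
    simpa using h.abs.add (tendsto_one_div_add_atTop_nhds_zero_nat.const_mul (2 * C))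
  refine squeeze_zero_norm' ?_ (hb.comp hsqrt)
  filter_upwards [eventually_ge_atTop 1] with T hT
  obtain ⟨m, hm⟩ : ∃ m, Nat.sqrt T = m + 1 :=
    ⟨Nat.sqrt T - 1, by have : 0 < Nat.sqrt T := Nat.sqrt_pos.2 hT; omega⟩
  have h1 : (m + 1) ^ 2 ≤ T := hm ▸ Nat.sqrt_le' T
  have h2 : T ≤ (m + 1) ^ 2 + 2 * (m + 1) := by
    have := Nat.sqrt_le_add T
    rw [hm] at this
    nlinarith
  simp only [Function.comp, hm, Nat.add_sub_cancel]
  have hsplit : ∑ k ∈ Finset.range T, y k = (∑ k ∈ Finset.range ((m + 1) ^ 2), y k) +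
      ∑ k ∈ Finset.Ico ((m + 1) ^ 2) T, y k :=
    (Finset.sum_range_add_sum_Ico y h1).symm
  have hrest : |∑ k ∈ Finset.Ico ((m + 1) ^ 2) T, y k| ≤ 2 * C * ((m : ℝ) + 1) := by
    calc |∑ k ∈ Finset.Ico ((m + 1) ^ 2) T, y k|
        ≤ ∑ k ∈ Finset.Ico ((m + 1) ^ 2) T, |y k| := Finset.abs_sum_le_sum_abs _ _
      _ ≤ ∑ _k ∈ Finset.Ico ((m + 1) ^ 2) T, C := Finset.sum_le_sum fun k _ => hy k
      _ = ((T - (m + 1) ^ 2 : ℕ) : ℝ) * C := by simp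
      _ ≤ ((2 * (m + 1) : ℕ) : ℝ) * C := by
          gcongr
          omega
      _ = 2 * C * ((m : ℝ) + 1) := by push_cast; ring
  have hmpos : (0 : ℝ) < (m : ℝ) + 1 := by positivity
  have hTpos : (0 : ℝ) < T := by exact_mod_cast hT
  have hmT : ((m : ℝ) + 1) ^ 2 ≤ T := by exact_mod_cast h1
  rw [Real.norm_eq_abs, abs_div, abs_div, abs_of_pos hTpos, abs_of_pos (by positivity :
    (0 : ℝ) < ((m : ℝ) + 1) ^ 2)]
  calc |∑ k ∈ Finset.range T, y k| / T
      ≤ |∑ k ∈ Finset.range T, y k| / ((m : ℝ) + 1) ^ 2 := by gcongr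
    _ ≤ (|∑ k ∈ Finset.range ((m + 1) ^ 2), y k| + 2 * C * ((m : ℝ) + 1)) /
          ((m : ℝ) + 1) ^ 2 := by
        gcongr
        rw [hsplit]
        exact (abs_add_le _ _).trans (by gcongr)
    _ = _ := by field_simp

-- At time (n+1)² the average has second moment at most D/(n+1)². These bounds are summable, so the
-- squared averages along the squares are almost surely summable and tend to 0.
open Topology in
theorem ae_tendsto_avg_zero_of_integral_sq_le {Ω : Type*} [MeasurableSpace Ω] {μ : Measure Ω}
    {Y : ℕ → Ω → ℝ} {C D : ℝ} (hY : ∀ k, Measurable (Y k)) (hC : ∀ k ω, |Y k ω| ≤ C)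
    [IsProbabilityMeasure μ]
    (hsq : ∀ T : ℕ, ∫ ω, (∑ k ∈ Finset.range T, Y k ω) ^ 2 ∂μ ≤ D * T) :
    ∀ᵐ ω ∂μ, Tendsto (fun T : ℕ => (∑ k ∈ Finset.range T, Y k ω) / T) atTop (𝓝 0) := by
  let Z : ℕ → Ω → ℝ := fun n ω =>
    (∑ k ∈ Finset.range ((n + 1) ^ 2), Y k ω) / ((n : ℝ) + 1) ^ 2
  have hS : ∀ T : ℕ, Measurable fun ω => ∑ k ∈ Finset.range T, Y k ω := fun T =>
    Finset.measurable_fun_sum _ fun k _ => hY k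
  have hZ : ∀ n, Measurable (Z n) := fun n => (hS _).div_const _
  have hint : ∀ T : ℕ, Integrable (fun ω => (∑ k ∈ Finset.range T, Y k ω) ^ 2) μ := by
    intro T
    refine Integrable.of_bound ((hS T).pow_const 2).aestronglyMeasurable ((T * C) ^ 2)
      (ae_of_all _ fun ω => ?_)
    rw [norm_pow, Real.norm_eq_abs]
    gcongr
    calc |∑ k ∈ Finset.range T, Y k ω| ≤ ∑ k ∈ Finset.range T, |Y k ω| :=
          Finset.abs_sum_le_sum_abs _ _
      _ ≤ ∑ _k ∈ Finset.range T, C := Finset.sum_le_sum fun k _ => hC k ω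
      _ = T * C := by simp
  have hZsq : ∀ n, ∫⁻ ω, ENNReal.ofReal (Z n ω ^ 2) ∂μ ≤
      ENNReal.ofReal (D * (1 / ((n : ℝ) + 1) ^ 2)) := by
    intro n
    have e : (fun ω => Z n ω ^ 2) = fun ω =>
        (∑ k ∈ Finset.range ((n + 1) ^ 2), Y k ω) ^ 2 / (((n : ℝ) + 1) ^ 2) ^ 2 := by
      funext ω
      simp only [Z, div_pow]
    rw [← ofReal_integral_eq_lintegral_ofReal (by rw [e]; exact (hint _).div_const _)
      (ae_of_all _ fun ω => sq_nonneg _), e, integral_div]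
    apply ENNReal.ofReal_le_ofReal
    rw [div_le_iff₀ (by positivity)]
    refine (hsq _).trans (le_of_eq ?_)
    push_cast
    field_simp
  have hsum : ∫⁻ ω, ∑' n, ENNReal.ofReal (Z n ω ^ 2) ∂μ ≠ ⊤ := by
    rw [lintegral_tsum fun n => ((hZ n).pow_const 2).ennreal_ofReal.aemeasurable]
    refine ne_top_of_le_ne_top ?_ (ENNReal.tsum_le_tsum hZsq)
    have hs : Summable fun n : ℕ => D * (1 / ((n : ℝ) + 1) ^ 2) := by
      apply Summable.mul_left
      have := (summable_nat_add_iff 1).2 (Real.summable_one_div_nat_pow.2 one_lt_two)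
      simpa using this
    exact hs.tsum_ofReal_ne_top
  have hfin := ae_lt_top (Measurable.tsum fun n => ((hZ n).pow_const 2).ennreal_ofReal) hsum
  filter_upwards [hfin] with ω hω
  refine tendsto_div_of_tendsto_div_sq (fun k => hC k ω) ?_
  have h1 := ENNReal.tendsto_atTop_zero_of_tsum_ne_top hω.ne
  have h2 : Tendsto (fun n => Z n ω ^ 2) atTop (𝓝 0) := by
    have := (ENNReal.tendsto_toReal ENNReal.zero_ne_top).comp h1
    simpa [Function.comp_def, ENNReal.toReal_ofReal (sq_nonneg _)] using this
  have h3 := h2.sqrt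
  simp only [Real.sqrt_sq_eq_abs, Real.sqrt_zero] at h3
  exact (tendsto_zero_iff_abs_tendsto_zero _).2 h3

section Trajectory

variable {X : Type*} [MeasurableSpace X] (μ₀ : Measure X) [IsProbabilityMeasure μ₀]
  (κ : (n : ℕ) → Kernel ((i : Finset.Iic n) → X) X) [∀ n, IsMarkovKernel (κ n)]

/-- Given the first coordinates up to `k`, the next one has law `κ k`, so the deviation of `ψ` from
its conditional mean is orthogonal to every bounded function of the past. -/
theorem integral_trajMeasure_mul_sub_eq_zero {k : ℕ} {F : ((i : Finset.Iic k) → X) → ℝ}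
    {ψ : X → ℝ} {C C' : ℝ} (hF : Measurable F) (hψ : Measurable ψ) (hFC : ∀ y, |F y| ≤ C')
    (hψC : ∀ z, |ψ z| ≤ C) :
    ∫ ω, F (Preorder.frestrictLe k ω) *
        (ψ (ω (k + 1)) - ∫ z, ψ z ∂κ k (Preorder.frestrictLe k ω))
      ∂(Kernel.trajMeasure (X := fun _ => X) μ₀ κ) = 0 := by
  set μ := Kernel.trajMeasure (X := fun _ => X) μ₀ κ
  have hκ : Measurable fun y => ∫ z, ψ z ∂κ k y :=
    (hψ.stronglyMeasurable.comp_measurable measurable_snd).integral_kernel_prod_right'.measurable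
  have hκC : ∀ y, |∫ z, ψ z ∂κ k y| ≤ C := fun y => by
    have := norm_integral_le_of_norm_le_const (f := ψ) (μ := κ k y) (ae_of_all _ hψC)
    simpa using this
  let Φ : (((i : Finset.Iic k) → X) × X) → ℝ := fun p =>
    F p.1 * (ψ p.2 - ∫ z, ψ z ∂κ k p.1)
  have hΦ : Measurable Φ :=
    (hF.comp measurable_fst).mul ((hψ.comp measurable_snd).sub (hκ.comp measurable_fst))
  have key := Kernel.map_frestrictLe_trajMeasure_compProd_eq_map_trajMeasure
    (X := fun _ => X) (μ₀ := μ₀) (κ := κ) (a := k)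
  have hmeas : Measurable (Preorder.frestrictLe (π := fun _ : ℕ => X) k) := by fun_prop
  have : IsProbabilityMeasure (μ.map (Preorder.frestrictLe (π := fun _ : ℕ => X) k)) :=
    Measure.isProbabilityMeasure_map hmeas.aemeasurable
  have h1 : ∫ p, Φ p ∂(μ.map (fun x => (Preorder.frestrictLe (π := fun _ : ℕ => X) k x, x (k + 1))))
      = ∫ ω, Φ (Preorder.frestrictLe k ω, ω (k + 1)) ∂μ :=
    integral_map (by fun_prop) hΦ.aestronglyMeasurable
  rw [← key, Measure.integral_compProd] at h1
  · refine h1.symm.trans ?_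
    have h0 : ∀ y, ∫ z, Φ (y, z) ∂κ k y = 0 := by
      intro y
      have hi : Integrable ψ (κ k y) :=
        Integrable.of_bound hψ.aestronglyMeasurable C (ae_of_all _ hψC)
      simp only [Φ]
      rw [integral_const_mul, integral_sub hi (integrable_const _)]
      simp
    simp [h0]
  · refine Integrable.of_bound hΦ.aestronglyMeasurable (C' * (C + C)) (ae_of_all _ fun p => ?_)
    rw [Real.norm_eq_abs, abs_mul]
    have hC' : 0 ≤ C' := (abs_nonneg _).trans (hFC p.1)
    gcongr
    · exact hFC _
    · exact (abs_sub _ _).trans (add_le_add (hψC _) (hκC _))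

open Topology in
/-- Strong law of large numbers for the deviations of a bounded observable from its conditional
expectations along a trajectory. -/
theorem ae_tendsto_avg_sub_condMean {ψ : X → ℝ} {C : ℝ} (hψ : Measurable ψ)
    (hψC : ∀ z, |ψ z| ≤ C) :
    ∀ᵐ ω ∂(Kernel.trajMeasure (X := fun _ => X) μ₀ κ),
      Tendsto (fun T : ℕ => (∑ k ∈ Finset.range T,
        (ψ (ω (k + 1)) - ∫ z, ψ z ∂κ k (Preorder.frestrictLe k ω))) / T) atTop (𝓝 0) := by
  set μ := Kernel.trajMeasure (X := fun _ => X) μ₀ κ with hμ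
  have : Nonempty X := by
    by_contra hX
    rw [not_nonempty_iff] at hX
    have h1 : μ₀ Set.univ = 1 := measure_univ
    simp [Set.univ_eq_empty_iff.2 hX] at h1
  let Y : ℕ → (ℕ → X) → ℝ := fun k ω =>
    ψ (ω (k + 1)) - ∫ z, ψ z ∂κ k (Preorder.frestrictLe (π := fun _ : ℕ => X) k ω)
  have hκ : ∀ k, Measurable fun y => ∫ z, ψ z ∂κ k y := fun k =>
    (hψ.stronglyMeasurable.comp_measurable measurable_snd).integral_kernel_prod_right'.measurable
  have hκC : ∀ k y, |∫ z, ψ z ∂κ k y| ≤ C := fun k y => by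
    have := norm_integral_le_of_norm_le_const (f := ψ) (μ := κ k y) (ae_of_all _ hψC)
    simpa using this
  have hYm : ∀ k, Measurable (Y k) := fun k =>
    (hψ.comp (measurable_pi_apply _)).sub ((hκ k).comp (by fun_prop))
  have hYC : ∀ k ω, |Y k ω| ≤ C + C := fun k ω =>
    (abs_sub _ _).trans (add_le_add (hψC _) (hκC _ _))
  -- Deviations are bounded by `C + C` and pairwise orthogonal, so their second moments add up.
  refine ae_tendsto_avg_zero_of_integral_sq_le (D := (C + C) ^ 2) hYm hYC fun T => ?_
  have hSm : ∀ T : ℕ, Measurable fun ω => ∑ k ∈ Finset.range T, Y k ω := fun T =>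
    Finset.measurable_fun_sum _ fun k _ => hYm k
  have hSC : ∀ (T : ℕ) ω, |∑ k ∈ Finset.range T, Y k ω| ≤ T * (C + C) := fun T ω =>
    calc |∑ k ∈ Finset.range T, Y k ω| ≤ ∑ k ∈ Finset.range T, |Y k ω| :=
          Finset.abs_sum_le_sum_abs _ _
      _ ≤ ∑ _k ∈ Finset.range T, (C + C) := Finset.sum_le_sum fun k _ => hYC k ω
      _ = T * (C + C) := by rw [Finset.sum_const, Finset.card_range, nsmul_eq_mul]
  induction T with
  | zero => simp
  | succ T ih =>
    -- Padding a history with an arbitrary point turns the sum of the first `T` deviations, which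
    -- only looks at coordinates up to `T`, into a function of the history.
    let e : ((i : Finset.Iic T) → X) → ℕ → X := fun y i =>
      if hi : i ≤ T then y ⟨i, Finset.mem_Iic.2 hi⟩ else Classical.arbitrary X
    have he : Measurable e := by
      refine measurable_pi_lambda _ fun i => ?_
      by_cases hi : i ≤ T
      · simp only [e, hi, dite_true]
        exact measurable_pi_apply _
      · simp only [e, hi, dite_false]
        exact measurable_const
    have heS : ∀ ω : ℕ → X,
        ∑ k ∈ Finset.range T, Y k (e (Preorder.frestrictLe (π := fun _ : ℕ => X) T ω)) =
          ∑ k ∈ Finset.range T, Y k ω := by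
      intro ω
      refine Finset.sum_congr rfl fun k hk => ?_
      have hk' := Finset.mem_range.1 hk
      have h1 : e (Preorder.frestrictLe (π := fun _ : ℕ => X) T ω) (k + 1) = ω (k + 1) := by
        simp [e, Nat.succ_le_iff.2 hk']
      have h2 : Preorder.frestrictLe (π := fun _ : ℕ => X) k
          (e (Preorder.frestrictLe (π := fun _ : ℕ => X) T ω)) =
          Preorder.frestrictLe (π := fun _ : ℕ => X) k ω := by
        funext i
        have hi : (i : ℕ) ≤ T := (Finset.mem_Iic.1 i.2).trans hk'.le
        simp [e, hi]
      simp only [Y, h1, h2]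
    have horth := integral_trajMeasure_mul_sub_eq_zero μ₀ κ (k := T)
      (F := fun y => ∑ k ∈ Finset.range T, Y k (e y)) ((hSm T).comp he) hψ
      (fun y => hSC T (e y)) hψC
    simp only [heS] at horth
    have hI : ∀ {f : (ℕ → X) → ℝ} {B : ℝ}, Measurable f → (∀ ω, |f ω| ≤ B) → Integrable f μ :=
      fun hf hB => Integrable.of_bound hf.aestronglyMeasurable _ (ae_of_all _ hB)
    have hi1 : Integrable (fun ω => (∑ k ∈ Finset.range T, Y k ω) ^ 2) μ :=
      hI (B := (T * (C + C)) ^ 2) ((hSm T).pow_const 2) fun ω => by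
        rw [abs_pow]
        exact pow_le_pow_left₀ (abs_nonneg _) (hSC T ω) 2
    have hi2 : Integrable (fun ω => 2 * ((∑ k ∈ Finset.range T, Y k ω) * Y T ω)) μ :=
      (hI (B := (T * (C + C)) * (C + C)) ((hSm T).mul (hYm T)) fun ω => by
        rw [Pi.mul_apply, abs_mul]
        exact mul_le_mul (hSC T ω) (hYC T ω) (abs_nonneg _)
          ((abs_nonneg _).trans (hSC T ω))).const_mul 2
    have hi3 : Integrable (fun ω => Y T ω ^ 2) μ :=
      hI (B := (C + C) ^ 2) ((hYm T).pow_const 2) fun ω => by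
        rw [abs_pow]
        exact pow_le_pow_left₀ (abs_nonneg _) (hYC T ω) 2
    have hY2 : ∫ ω, Y T ω ^ 2 ∂μ ≤ (C + C) ^ 2 := by
      have := integral_mono hi3 (integrable_const ((C + C) ^ 2)) fun ω => by
        show Y T ω ^ 2 ≤ (C + C) ^ 2
        rw [← sq_abs]
        exact pow_le_pow_left₀ (abs_nonneg _) (hYC T ω) 2
      simpa using this
    have hexp : ∫ ω, (∑ k ∈ Finset.range (T + 1), Y k ω) ^ 2 ∂μ =
        ∫ ω, (∑ k ∈ Finset.range T, Y k ω) ^ 2 ∂μ + ∫ ω, Y T ω ^ 2 ∂μ := by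
      calc ∫ ω, (∑ k ∈ Finset.range (T + 1), Y k ω) ^ 2 ∂μ
          = ∫ ω, ((∑ k ∈ Finset.range T, Y k ω) ^ 2 +
              2 * ((∑ k ∈ Finset.range T, Y k ω) * Y T ω) + Y T ω ^ 2) ∂μ := by
            congr 1 with ω
            rw [Finset.sum_range_succ]
            ring
        _ = _ := by
            have h12 := integral_add hi1 hi2
            have h123 := integral_add (hi1.add hi2) hi3
            simp only [Pi.add_apply] at h123
            rw [h123, h12, integral_const_mul,
              show ∫ ω, (∑ k ∈ Finset.range T, Y k ω) * Y T ω ∂μ = 0 from horth]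
            ring
    rw [hexp]
    push_cast
    linarith

end Trajectory

/-! ### Means under finite distributions -/

/-- The mean of a real function under a probability mass function on a finite type. -/
def pmfMean {α : Type*} [Fintype α] (p : PMF α) (f : α → ℝ) : ℝ := ∑ a, (p a).toReal * f a

section pmfMean

variable {α β : Type*} [Fintype α] [Fintype β]

theorem PMF.sum_toReal (p : PMF α) : ∑ a, (p a).toReal = 1 := by
  rw [← ENNReal.toReal_sum fun a _ => p.apply_ne_top a, ← tsum_fintype (L := .unconditional _),
    p.tsum_coe]
  rfl

theorem pmfMean_mono_of_support {p : PMF α} {f g : α → ℝ} (h : ∀ a ∈ p.support, f a ≤ g a) :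
    pmfMean p f ≤ pmfMean p g := by
  refine Finset.sum_le_sum fun a _ => ?_
  by_cases ha : a ∈ p.support
  · exact mul_le_mul_of_nonneg_left (h a ha) ENNReal.toReal_nonneg
  · simp [(p.apply_eq_zero_iff a).2 ha]

theorem pmfMean_mono {p : PMF α} {f g : α → ℝ} (h : ∀ a, f a ≤ g a) :
    pmfMean p f ≤ pmfMean p g :=
  pmfMean_mono_of_support fun a _ => h a

@[simp]
theorem pmfMean_const (p : PMF α) (c : ℝ) : pmfMean p (fun _ => c) = c := by
  rw [pmfMean, ← Finset.sum_mul, p.sum_toReal, one_mul]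

theorem pmfMean_add (p : PMF α) (f g : α → ℝ) :
    pmfMean p (fun a => f a + g a) = pmfMean p f + pmfMean p g := by
  simp only [pmfMean, mul_add, Finset.sum_add_distrib]

theorem pmfMean_sub (p : PMF α) (f g : α → ℝ) :
    pmfMean p (fun a => f a - g a) = pmfMean p f - pmfMean p g := by
  simp only [pmfMean, mul_sub, Finset.sum_sub_distrib]

theorem pmfMean_const_mul (p : PMF α) (c : ℝ) (f : α → ℝ) :
    pmfMean p (fun a => c * f a) = c * pmfMean p f := by
  simp only [pmfMean, Finset.mul_sum]
  exact Finset.sum_congr rfl fun a _ => by ring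

theorem pmfMean_comm (p : PMF α) (q : PMF β) (f : α → β → ℝ) :
    pmfMean p (fun a => pmfMean q (f a)) = pmfMean q fun b => pmfMean p fun a => f a b := by
  simp only [pmfMean, Finset.mul_sum]
  rw [Finset.sum_comm]
  exact Finset.sum_congr rfl fun b _ => Finset.sum_congr rfl fun a _ => by ring

theorem pmfMean_bind (p : PMF α) (k : α → PMF β) (f : β → ℝ) :
    pmfMean (p.bind k) f = pmfMean p fun a => pmfMean (k a) f := by
  simp only [pmfMean, PMF.bind_apply, tsum_fintype]
  simp_rw [Finset.mul_sum]
  rw [Finset.sum_comm]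
  refine Finset.sum_congr rfl fun b _ => ?_
  rw [ENNReal.toReal_sum fun a _ => ENNReal.mul_ne_top (p.apply_ne_top a) ((k a).apply_ne_top b),
    Finset.sum_mul]
  exact Finset.sum_congr rfl fun a _ => by rw [ENNReal.toReal_mul, mul_assoc]

theorem pmfMean_pure (a : α) (f : α → ℝ) : pmfMean (PMF.pure a) f = f a := by
  classical
  rw [pmfMean, Finset.sum_eq_single a]
  · simp
  · intro b _ hb
    simp [PMF.pure_apply, hb]
  · simp

theorem pmfMean_map (p : PMF α) (k : α → β) (f : β → ℝ) :
    pmfMean (p.map k) f = pmfMean p fun a => f (k a) := by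
  rw [← PMF.bind_pure_comp, pmfMean_bind]
  simp [pmfMean_pure]

theorem mul_le_pmfMean {p : PMF α} {f : α → ℝ} (hf : ∀ a, 0 ≤ f a) (a : α) :
    (p a).toReal * f a ≤ pmfMean p f :=
  Finset.single_le_sum (f := fun a => (p a).toReal * f a)
    (fun b _ => mul_nonneg ENNReal.toReal_nonneg (hf b)) (Finset.mem_univ a)

theorem abs_pmfMean_le {p : PMF α} {f : α → ℝ} {C : ℝ} (hf : ∀ a, |f a| ≤ C) :
    |pmfMean p f| ≤ C := by
  rw [abs_le]
  constructor
  · simpa using pmfMean_mono (p := p) fun a => (abs_le.1 (hf a)).1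
  · simpa using pmfMean_mono (p := p) fun a => (abs_le.1 (hf a)).2

theorem integral_toMeasure_eq_pmfMean [MeasurableSpace α] [MeasurableSingletonClass α]
    (p : PMF α) (f : α → ℝ) : ∫ a, f a ∂p.toMeasure = pmfMean p f := by
  rw [PMF.integral_eq_sum]
  rfl

theorem continuous_pmfMean (p : PMF α) : Continuous (pmfMean p) := by
  unfold pmfMean
  fun_prop

end pmfMean

/-! ### Matrix games -/

/-- `v` is the value of the matrix game `M` with available rows `A` (maximizing player) and
available columns `B` (minimizing player). -/
def IsMatrixValue {Act : Type*} [Fintype Act] (A B : Finset Act) (M : Act → Act → ℝ) (v : ℝ) :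
    Prop :=
  ∃ p q : PMF Act, (∀ a ∈ p.support, a ∈ A) ∧ (∀ b ∈ q.support, b ∈ B) ∧
    (∀ b ∈ B, v ≤ pmfMean p fun a => M a b) ∧ ∀ a ∈ A, pmfMean q (M a) ≤ v

section MatrixGame

variable {Act : Type*} [Fintype Act]

/-- Mixed moves supported on `A`, as vectors. -/
def mixedMoves (A : Finset Act) : Set (Act → ℝ) := {x | x ∈ stdSimplex ℝ Act ∧ ∀ a ∉ A, x a = 0}

theorem convex_mixedMoves (A : Finset Act) : Convex ℝ (mixedMoves A) := by
  rintro x ⟨hx, hx'⟩ y ⟨hy, hy'⟩ a b ha hb hab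
  refine ⟨convex_stdSimplex ℝ Act hx hy ha hb hab, fun c hc => ?_⟩
  simp [hx' c hc, hy' c hc]

theorem isCompact_mixedMoves (A : Finset Act) : IsCompact (mixedMoves A) := by
  have : mixedMoves A = stdSimplex ℝ Act ∩ ⋂ a ∈ {a | a ∉ A}, {x | x a = 0} := by
    ext x
    simp [mixedMoves]
  rw [this]
  refine (isCompact_stdSimplex ℝ Act).inter_right ?_
  exact isClosed_biInter fun a _ => isClosed_eq (continuous_apply a) continuous_const

theorem single_mem_mixedMoves [DecidableEq Act] {A : Finset Act} {a : Act} (ha : a ∈ A) :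
    Pi.single a 1 ∈ mixedMoves A :=
  ⟨single_mem_stdSimplex ℝ a, fun b hb => by
    have : b ≠ a := fun h => hb (h ▸ ha)
    simp [this]⟩

theorem exists_pmf_of_mem_mixedMoves {A : Finset Act} {x : Act → ℝ} (hx : x ∈ mixedMoves A) :
    ∃ p : PMF Act, (∀ a ∈ p.support, a ∈ A) ∧ ∀ f : Act → ℝ, pmfMean p f = ∑ a, x a * f a := by
  obtain ⟨⟨h0, h1⟩, hA⟩ := hx
  refine ⟨PMF.ofFintype (fun a => ENNReal.ofReal (x a)) ?_, fun a ha => ?_, fun f => ?_⟩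
  · rw [← ENNReal.ofReal_sum_of_nonneg fun a _ => h0 a, h1, ENNReal.ofReal_one]
  · by_contra hc
    simp [hA a hc] at ha
  · simp [pmfMean, ENNReal.toReal_ofReal (h0 _)]

/-- The mean payoff is bilinear on the compact convex sets of mixed moves, so Sion's theorem gives a
saddle point; testing it against pure moves gives both guarantees. -/
theorem exists_isMatrixValue {A B : Finset Act} (hA : A.Nonempty) (hB : B.Nonempty)
    (M : Act → Act → ℝ) : ∃ v, IsMatrixValue A B M v := by
  classical
  let f : (Act → ℝ) → (Act → ℝ) → ℝ := fun y x => ∑ a, x a * ∑ b, y b * M a b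
  have hf : ∀ y x, f y x = ∑ b, y b * ∑ a, x a * M a b := fun y x => by
    simp only [f, Finset.mul_sum]
    rw [Finset.sum_comm]
    exact Finset.sum_congr rfl fun b _ => Finset.sum_congr rfl fun a _ => by ring
  have hlin : ∀ c : Act → ℝ, IsLinearMap ℝ fun x : Act → ℝ => ∑ a, x a * c a := fun c =>
    ⟨fun x y => by simp [add_mul, Finset.sum_add_distrib],
      fun r x => by simp [Finset.mul_sum, mul_assoc]⟩
  obtain ⟨a₀, ha₀⟩ := hA
  obtain ⟨b₀, hb₀⟩ := hB
  -- The first variable is the minimizing one, hence the columns `B` come first.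
  obtain ⟨y, hy, x, hx, hsaddle⟩ := Sion.exists_isSaddlePointOn (X := mixedMoves B)
    (Y := mixedMoves A) (f := f) ⟨_, single_mem_mixedMoves hb₀⟩ (convex_mixedMoves B)
    (isCompact_mixedMoves B)
    (fun x _ => by
      have : Continuous fun y => f y x := by simp only [f]; fun_prop
      exact this.lowerSemicontinuous.lowerSemicontinuousOn _)
    (fun x _ => by
      simp only [hf]
      exact (((hlin _).mk' _).convexOn (convex_mixedMoves B)).quasiconvexOn)
    (convex_mixedMoves A) ⟨_, single_mem_mixedMoves ha₀⟩ (isCompact_mixedMoves A)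
    (fun y _ => by
      have : Continuous fun x => f y x := by simp only [f]; fun_prop
      exact this.upperSemicontinuous.upperSemicontinuousOn _)
    (fun y _ => by
      simp only [f]
      exact (((hlin _).mk' _).concaveOn (convex_mixedMoves A)).quasiconcaveOn)
  obtain ⟨p, hp, hpm⟩ := exists_pmf_of_mem_mixedMoves hx
  obtain ⟨q, hq, hqm⟩ := exists_pmf_of_mem_mixedMoves hy
  refine ⟨f y x, p, q, hp, hq, fun b hb => ?_, fun a ha => ?_⟩
  · have := hsaddle _ (single_mem_mixedMoves hb) x hx
    rw [hpm]
    simpa [f, Pi.single_apply] using this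
  · have := hsaddle y hy _ (single_mem_mixedMoves ha)
    rw [hqm]
    simpa [f, Pi.single_apply] using this

namespace IsMatrixValue

variable {A B : Finset Act} {M M' : Act → Act → ℝ} {v v' c : ℝ}

/-- Pit the optimal row mixture of `M` against the optimal column mixture of `M'`. The consequence
is that matrix values are unique and 1-Lipschitz in the sup norm. -/
theorem le_add (h : IsMatrixValue A B M v) (h' : IsMatrixValue A B M' v')
    (hM : ∀ a ∈ A, ∀ b ∈ B, M a b ≤ M' a b + c) : v ≤ v' + c := by
  obtain ⟨p, _, hp, _, hpv, _⟩ := h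
  obtain ⟨_, q, _, hq, _, hqv⟩ := h'
  calc v = pmfMean q fun _ => v := (pmfMean_const q v).symm
    _ ≤ pmfMean q fun b => pmfMean p fun a => M a b :=
        pmfMean_mono_of_support fun b hb => hpv b (hq b hb)
    _ = pmfMean p fun a => pmfMean q fun b => M a b := (pmfMean_comm p q M).symm
    _ ≤ pmfMean p fun _ => v' + c := pmfMean_mono_of_support fun a ha => by
        calc pmfMean q (M a) ≤ pmfMean q fun b => M' a b + c :=
              pmfMean_mono_of_support fun b hb => hM a (hp a ha) b (hq b hb)
          _ = pmfMean q (M' a) + c := by rw [pmfMean_add, pmfMean_const]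
          _ ≤ v' + c := by linarith [hqv a (hp a ha)]
    _ = v' + c := pmfMean_const p _

theorem abs_sub_le (h : IsMatrixValue A B M v) (h' : IsMatrixValue A B M' v')
    (hM : ∀ a ∈ A, ∀ b ∈ B, |M a b - M' a b| ≤ c) : |v - v'| ≤ c := by
  rw [abs_le]
  have h1 := h.le_add h' (c := c) fun a ha b hb => by linarith [(abs_le.1 (hM a ha b hb)).2]
  have h2 := h'.le_add h (c := c) fun a ha b hb => by linarith [(abs_le.1 (hM a ha b hb)).1]
  constructor <;> linarith

theorem add_const (h : IsMatrixValue A B M v) (c : ℝ) :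
    IsMatrixValue A B (fun a b => M a b + c) (v + c) := by
  obtain ⟨p, q, hp, hq, hpv, hqv⟩ := h
  refine ⟨p, q, hp, hq, fun b hb => ?_, fun a ha => ?_⟩
  · rw [pmfMean_add, pmfMean_const]
    linarith [hpv b hb]
  · rw [pmfMean_add, pmfMean_const]
    linarith [hqv a ha]

theorem le_of_forall_le (h : IsMatrixValue A B M v) (hM : ∀ a ∈ A, ∀ b ∈ B, M a b ≤ c) :
    v ≤ c := by
  obtain ⟨p, q, hp, hq, hpv, -⟩ := h
  obtain ⟨b, hb⟩ := q.support_nonempty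
  refine (hpv b (hq b hb)).trans ?_
  simpa using pmfMean_mono_of_support (p := p) (g := fun _ => c)
    fun a ha => hM a (hp a ha) b (hq b hb)

theorem le_of_forall_ge (h : IsMatrixValue A B M v) (hM : ∀ a ∈ A, ∀ b ∈ B, c ≤ M a b) :
    c ≤ v := by
  obtain ⟨p, q, hp, hq, -, hqv⟩ := h
  obtain ⟨a, ha⟩ := p.support_nonempty
  refine le_trans ?_ (hqv a (hp a ha))
  simpa using pmfMean_mono_of_support (p := q) (f := fun _ => c)
    fun b hb => hM a (hp a ha) b (hq b hb)

-- No limit of optimal mixtures is needed: `M` has some value `w`, and the Lipschitz bound forces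
-- `u` to converge to `w`.
open Topology in
theorem of_tendsto (hA : A.Nonempty) (hB : B.Nonempty) {ι : Type*} {l : Filter ι} [l.NeBot]
    {N : ι → Act → Act → ℝ} {u : ι → ℝ} (h : ∀ i, IsMatrixValue A B (N i) (u i))
    (hN : Tendsto N l (𝓝 M)) (hu : Tendsto u l (𝓝 v)) : IsMatrixValue A B M v := by
  obtain ⟨w, hw⟩ := exists_isMatrixValue hA hB M
  have hdist : ∀ i, |u i - w| ≤ dist (N i) M := fun i =>
    (h i).abs_sub_le hw fun a _ b _ => by
      rw [← Real.dist_eq]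
      exact (dist_le_pi_dist (N i a) (M a) b).trans (dist_le_pi_dist (N i) M a)
  have hlim : Tendsto u l (𝓝 w) := by
    rw [tendsto_iff_dist_tendsto_zero]
    exact squeeze_zero (fun _ => dist_nonneg) (fun i => by rw [Real.dist_eq]; exact hdist i)
      (tendsto_iff_dist_tendsto_zero.1 hN)
  exact tendsto_nhds_unique hu hlim ▸ hw

end IsMatrixValue

end MatrixGame

/-! ### The average-reward optimality equation by vanishing discount -/

namespace ConcurrentGame

variable {S Act : Type} [Fintype S] [Fintype Act]

/-- The Bellman operator of the game with discount factor `d`. -/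
def discountedBellman (G : ConcurrentGame S Act) (r : S → Act → Act → ℝ) (d : ℝ) (u : S → ℝ) :
    S → ℝ := fun s =>
  Classical.choose (exists_isMatrixValue (G.moves₁_nonempty s) (G.moves₂_nonempty s)
    fun a b => r s a b + d * pmfMean (G.trans s a b) u)

theorem isMatrixValue_discountedBellman (G : ConcurrentGame S Act) (r : S → Act → Act → ℝ)
    (d : ℝ) (u : S → ℝ) (s : S) :
    IsMatrixValue (G.moves₁ s) (G.moves₂ s)
      (fun a b => r s a b + d * pmfMean (G.trans s a b) u) (G.discountedBellman r d u s) :=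
  Classical.choose_spec (exists_isMatrixValue (G.moves₁_nonempty s) (G.moves₂_nonempty s)
    fun a b => r s a b + d * pmfMean (G.trans s a b) u)

/-- Shapley's argument: matrix values are 1-Lipschitz and means do not expand distances, so the
Bellman operator is a `d`-contraction. -/
theorem exists_discounted_fixedPoint (G : ConcurrentGame S Act) (r : S → Act → Act → ℝ)
    {d : ℝ} (hd : 0 ≤ d) (hd' : d < 1) :
    ∃ u : S → ℝ, ∀ s, IsMatrixValue (G.moves₁ s) (G.moves₂ s)
      (fun a b => r s a b + d * pmfMean (G.trans s a b) u) (u s) := by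
  have hc : ContractingWith ⟨d, hd⟩ (G.discountedBellman r d) := by
    refine ⟨by exact_mod_cast hd', LipschitzWith.of_dist_le_mul fun u w => ?_⟩
    change _ ≤ d * dist u w
    refine (dist_pi_le_iff (by positivity)).2 fun s => ?_
    rw [Real.dist_eq]
    refine (G.isMatrixValue_discountedBellman r d u s).abs_sub_le
      (G.isMatrixValue_discountedBellman r d w s) fun a _ b _ => ?_
    rw [add_sub_add_left_eq_sub, ← mul_sub, ← pmfMean_sub, abs_mul, abs_of_nonneg hd]
    refine mul_le_mul_of_nonneg_left (abs_pmfMean_le fun t => ?_) hd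
    rw [← Real.dist_eq]
    exact dist_le_pi_dist u w t
  refine ⟨hc.fixedPoint, fun s => ?_⟩
  have h := G.isMatrixValue_discountedBellman r d hc.fixedPoint s
  rwa [hc.fixedPoint_isFixedPt.eq] at h

theorem exists_abs_reward_le (r : S → Act → Act → ℝ) : ∃ R, 0 ≤ R ∧ ∀ s a b, |r s a b| ≤ R := by
  obtain ⟨R, hR⟩ := (Set.finite_range fun x : S × Act × Act => |r x.1 x.2.1 x.2.2|).bddAbove
  refine ⟨max R 0, le_max_right _ _, fun s a b => ?_⟩
  exact (hR ⟨(s, a, b), rfl⟩).trans (le_max_left _ _)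

/-- `g` is a Lyapunov function with target `z`: whatever the moves, it decreases by at least `1`
in the mean as long as the target is not reached. -/
structure IsLyapunov (G : ConcurrentGame S Act) (z : S) (g : S → ℝ) : Prop where
  nonneg : ∀ s, 0 ≤ g s
  target : g z = 0
  drift : ∀ s, s ≠ z → ∀ a b, pmfMean (G.trans s a b) g ≤ g s - 1

-- A maximum principle for `w - K * g`: at a maximizer other than `z` the drift of `g` would give `w
-- t ≤ w t + R - K < w t`. Hypothesis `hw` says that `w s` is at most the largest `R + d * E[w]`
-- over all moves, without naming a maximizing pair.
omit [Fintype Act] in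
theorem IsLyapunov.le_mul {G : ConcurrentGame S Act} {z : S} {g : S → ℝ} (hg : G.IsLyapunov z g)
    {d R K : ℝ} (hd : 0 ≤ d) (hd' : d ≤ 1) (hK : R < K) (hK' : 0 ≤ K) {w : S → ℝ} (hwz : w z = 0)
    (hw : ∀ s c, (∀ a b, R + d * pmfMean (G.trans s a b) w ≤ c) → w s ≤ c) (s : S) :
    w s ≤ K * g s := by
  have : Nonempty S := ⟨z⟩
  obtain ⟨t, ht⟩ := Finite.exists_max fun s => w s - K * g s
  -- This sign allows the factor `d ≤ 1` to be dropped in `h4`.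
  have hm : 0 ≤ w t - K * g t := by
    have := ht z
    rwa [hwz, hg.target, mul_zero, sub_zero] at this
  by_cases htz : t = z
  · have := ht s
    rw [htz, hwz, hg.target] at this
    linarith
  · exfalso
    have := hw t (R + (K * (g t - 1) + (w t - K * g t))) fun a b => by
      have h1 : pmfMean (G.trans t a b) w ≤ K * pmfMean (G.trans t a b) g + (w t - K * g t) := by
        rw [← pmfMean_const_mul]
        conv_rhs => rw [← pmfMean_const (G.trans t a b) (w t - K * g t)]
        rw [← pmfMean_add]
        exact pmfMean_mono fun x => by linarith [ht x]
      have h2 : 0 ≤ pmfMean (G.trans t a b) g := by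
        simpa using pmfMean_mono (p := G.trans t a b) (f := fun _ => 0) hg.nonneg
      have h3 := mul_le_mul_of_nonneg_left (hg.drift t htz a b) hK'
      have h4 : d * pmfMean (G.trans t a b) w ≤
          K * pmfMean (G.trans t a b) g + (w t - K * g t) :=
        (mul_le_mul_of_nonneg_left h1 hd).trans (mul_le_of_le_one_left (by positivity) hd')
      linarith
    linarith

/-- With the discounted value `u`, take `v = (1 - d) * u z` and `w = u - u z`; subtracting a
constant from `u` turns the discounted equation into this one. What matters is that the bounds do
not depend on `d`. -/
theorem exists_bellman_approx {G : ConcurrentGame S Act} {z : S} {g : S → ℝ}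
    (hg : G.IsLyapunov z g) (r : S → Act → Act → ℝ) {R : ℝ} (hR : 0 ≤ R)
    (hr : ∀ s a b, |r s a b| ≤ R) {d : ℝ} (hd : 0 ≤ d) (hd' : d < 1) :
    ∃ (v : ℝ) (w : S → ℝ), |v| ≤ R ∧ (∀ s, |w s| ≤ (2 * R + 1) * g s) ∧
      ∀ s, IsMatrixValue (G.moves₁ s) (G.moves₂ s)
        (fun a b => r s a b + d * pmfMean (G.trans s a b) w) (v + w s) := by
  have : Nonempty S := ⟨z⟩
  obtain ⟨u, hu⟩ := G.exists_discounted_fixedPoint r hd hd'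
  have hup : ∀ s, (1 - d) * u s ≤ R := by
    obtain ⟨t, ht⟩ := Finite.exists_max u
    have h1 : u t ≤ R + d * u t := (hu t).le_of_forall_le fun a _ b _ => by
      have h2 := pmfMean_mono (p := G.trans t a b) ht
      rw [pmfMean_const] at h2
      have h3 := mul_le_mul_of_nonneg_left h2 hd
      linarith [(abs_le.1 (hr t a b)).2]
    intro s
    nlinarith [ht s]
  have hlow : ∀ s, -R ≤ (1 - d) * u s := by
    obtain ⟨t, ht⟩ := Finite.exists_min u
    have h1 : -R + d * u t ≤ u t := (hu t).le_of_forall_ge fun a _ b _ => by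
      have h2 := pmfMean_mono (p := G.trans t a b) ht
      rw [pmfMean_const] at h2
      have h3 := mul_le_mul_of_nonneg_left h2 hd
      linarith [(abs_le.1 (hr t a b)).1]
    intro s
    nlinarith [ht s]
  have hw : ∀ s, IsMatrixValue (G.moves₁ s) (G.moves₂ s)
      (fun a b => r s a b + d * pmfMean (G.trans s a b) fun t => u t - u z)
      ((1 - d) * u z + (u s - u z)) := fun s => by
    convert (hu s).add_const (-(d * u z)) using 1
    · funext a b
      rw [pmfMean_sub, pmfMean_const]
      ring
    · ring
  refine ⟨(1 - d) * u z, fun s => u s - u z, abs_le.2 ⟨hlow z, hup z⟩, fun s => abs_le.2 ⟨?_, ?_⟩,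
    hw⟩
  -- The reward and `v` are each at most `R` in absolute value, whence `2 * R`; the extra 1 in `K`
  -- makes the inequality `R < K` of `le_mul` strict.
  · have h := hg.le_mul (w := fun s => u z - u s) (R := 2 * R) (K := 2 * R + 1) hd hd'.le
      (by linarith) (by linarith) (sub_self _) (fun s c hc => ?_) s
    · linarith
    · have := (hw s).le_of_forall_ge (c := -R - (c - 2 * R)) fun a _ b _ => by
        have h1 := hc a b
        rw [pmfMean_sub, pmfMean_const] at h1
        rw [pmfMean_sub, pmfMean_const]
        linarith [(abs_le.1 (hr s a b)).1]
      linarith [hup z]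
  · have h := hg.le_mul (w := fun s => u s - u z) (R := 2 * R) (K := 2 * R + 1) hd hd'.le
      (by linarith) (by linarith) (sub_self _) (fun s c hc => ?_) s
    · linarith
    · have := (hw s).le_of_forall_le (c := R + (c - 2 * R)) fun a _ b _ => by
        have h1 := hc a b
        rw [pmfMean_sub, pmfMean_const] at h1
        rw [pmfMean_sub, pmfMean_const]
        linarith [(abs_le.1 (hr s a b)).2]
      linarith [hlow z]

open Topology in
/-- The average-reward optimality equation has a solution in a game with a Lyapunov function. -/
theorem IsLyapunov.exists_bellman {G : ConcurrentGame S Act} {z : S} {g : S → ℝ}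
    (hg : G.IsLyapunov z g) (r : S → Act → Act → ℝ) :
    ∃ (v : ℝ) (h : S → ℝ), ∀ s, IsMatrixValue (G.moves₁ s) (G.moves₂ s)
      (fun a b => r s a b + pmfMean (G.trans s a b) h) (v + h s) := by
  obtain ⟨R, hR, hr⟩ := exists_abs_reward_le r
  have hd : ∀ k : ℕ, 0 ≤ 1 - 1 / ((k : ℝ) + 1) ∧ 1 - 1 / ((k : ℝ) + 1) < 1 := fun k => by
    have h1 : (0 : ℝ) < 1 / ((k : ℝ) + 1) := by positivity
    have h2 : 1 / ((k : ℝ) + 1) ≤ 1 := by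
      rw [div_le_one (by positivity)]
      linarith [(k.cast_nonneg : (0 : ℝ) ≤ k)]
    constructor <;> linarith
  choose v w hv hw hvw using fun k => exists_bellman_approx hg r hR hr (hd k).1 (hd k).2
  -- The bounds uniform in the discount factor keep all pairs `(v k, w k)` in one compact set, so a
  -- subsequence converges.
  have hK : IsCompact (Metric.closedBall (0 : ℝ) R ×ˢ
      Metric.closedBall (0 : S → ℝ) ((2 * R + 1) * ∑ s, g s)) :=
    (isCompact_closedBall _ _).prod (isCompact_closedBall _ _)
  have hsum : ∀ s, g s ≤ ∑ s, g s := fun s =>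
    Finset.single_le_sum (fun t _ => hg.nonneg t) (Finset.mem_univ s)
  obtain ⟨⟨v₀, h₀⟩, -, φ, hφ, hlim⟩ := hK.tendsto_subseq (x := fun k => (v k, w k)) fun k => by
    refine ⟨by simpa using hv k, ?_⟩
    rw [mem_closedBall_zero_iff, pi_norm_le_iff_of_nonneg
      (mul_nonneg (by linarith) (Finset.sum_nonneg fun s _ => hg.nonneg s))]
    exact fun s => (hw k s).trans (mul_le_mul_of_nonneg_left (hsum s) (by linarith))
  have hlv : Tendsto (fun k => v (φ k)) atTop (𝓝 v₀) := (continuous_fst.tendsto _).comp hlim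
  have hlw : Tendsto (fun k => w (φ k)) atTop (𝓝 h₀) := (continuous_snd.tendsto _).comp hlim
  have hld : Tendsto (fun k => 1 - 1 / ((φ k : ℝ) + 1)) atTop (𝓝 1) := by
    have h1 : Tendsto (fun k => 1 / ((φ k : ℝ) + 1)) atTop (𝓝 0) :=
      (tendsto_one_div_add_atTop_nhds_zero_nat (𝕜 := ℝ)).comp hφ.tendsto_atTop
    simpa using h1.const_sub 1
  refine ⟨v₀, h₀, fun s => IsMatrixValue.of_tendsto (G.moves₁_nonempty s) (G.moves₂_nonempty s)
    (l := atTop) (fun k => hvw (φ k) s) ?_ (hlv.add (tendsto_pi_nhds.1 hlw s))⟩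
  refine tendsto_pi_nhds.2 fun a => tendsto_pi_nhds.2 fun b => ?_
  simpa using tendsto_const_nhds.add
    (hld.mul (((continuous_pmfMean (G.trans s a b)).tendsto h₀).comp hlw))

end ConcurrentGame

/-! ### From the optimality equation to values and recurrence -/

/-- The strategy that plays the mixed move `p s` whenever the current state is `s`. -/
def Strategy.stationary {S Act : Type} {moves : S → Finset Act} (p : S → PMF Act)
    (hp : ∀ s, ∀ a ∈ (p s).support, a ∈ moves s) : Strategy moves where
  dist _ s := p s
  support_subset _ s := hp s

/-- A saddle point yields equality of the lower and the upper value. -/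
theorem iSup_iInf_eq_and_iInf_iSup_eq {ι κ : Type*} {f g : ι → κ → ℝ} {R v : ℝ}
    (hf : ∀ i j, -R ≤ f i j) (hfg : ∀ i j, f i j ≤ g i j) (hg : ∀ i j, g i j ≤ R) {i₀ : ι} {j₀ : κ}
    (hi : ∀ j, v ≤ f i₀ j) (hj : ∀ i, g i j₀ ≤ v) :
    (⨆ i, ⨅ j, f i j) = v ∧ (⨅ j, ⨆ i, g i j) = v := by
  have : Nonempty ι := ⟨i₀⟩
  have : Nonempty κ := ⟨j₀⟩
  -- Boundedness has to be checked because real `⨅` and `⨆` take a default value on unbounded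
  -- families.
  have hbf : ∀ i, BddBelow (Set.range fun j => f i j) := fun i =>
    ⟨-R, by rintro _ ⟨j, rfl⟩; exact hf i j⟩
  have hbg : ∀ j, BddAbove (Set.range fun i => g i j) := fun j =>
    ⟨R, by rintro _ ⟨i, rfl⟩; exact hg i j⟩
  have h1 : ∀ i, ⨅ j, f i j ≤ v := fun i =>
    (ciInf_le (hbf i) j₀).trans ((hfg i j₀).trans (hj i))
  have h2 : ∀ j, v ≤ ⨆ i, g i j := fun j =>
    ((hi j).trans (hfg i₀ j)).trans (le_ciSup (hbg j) i₀)
  constructor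
  · exact le_antisymm (ciSup_le h1)
      ((le_ciInf hi).trans (le_ciSup (f := fun i => ⨅ j, f i j)
        ⟨v, by rintro _ ⟨i, rfl⟩; exact h1 i⟩ i₀))
  · exact le_antisymm
      ((ciInf_le (f := fun j => ⨆ i, g i j) ⟨v, by rintro _ ⟨j, rfl⟩; exact h2 j⟩ j₀).trans
        (ciSup_le hj)) (le_ciInf h2)

namespace ConcurrentGame

variable {S Act : Type}

section Average

variable {r : S → Act → Act → ℝ} {R : ℝ}

theorem abs_avg_le (hR : ∀ s a b, |r s a b| ≤ R) (ω : ℕ → S × Act × Act) (T : ℕ) :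
    |avg r ω T| ≤ R := by
  have hR0 : 0 ≤ R := (abs_nonneg _).trans (hR (ω 0).1 (ω 0).2.1 (ω 0).2.2)
  rw [avg, abs_div, Nat.abs_cast]
  refine div_le_of_le_mul₀ (Nat.cast_nonneg T) hR0 ?_
  calc _ ≤ ∑ k ∈ Finset.range T, |r (ω k).1 (ω k).2.1 (ω k).2.2| := Finset.abs_sum_le_sum_abs _ _
    _ ≤ ∑ _k ∈ Finset.range T, R := Finset.sum_le_sum fun k _ => hR _ _ _
    _ = R * T := by rw [Finset.sum_const, Finset.card_range, nsmul_eq_mul, mul_comm]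

theorem isBoundedUnder_le_avg (hR : ∀ s a b, |r s a b| ≤ R) (ω : ℕ → S × Act × Act) :
    IsBoundedUnder (· ≤ ·) atTop (avg r ω) :=
  isBoundedUnder_of ⟨R, fun T => (abs_le.1 (abs_avg_le hR ω T)).2⟩

theorem isBoundedUnder_ge_avg (hR : ∀ s a b, |r s a b| ≤ R) (ω : ℕ → S × Act × Act) :
    IsBoundedUnder (· ≥ ·) atTop (avg r ω) :=
  isBoundedUnder_of ⟨-R, fun T => (abs_le.1 (abs_avg_le hR ω T)).1⟩

theorem neg_le_limInfAvg (hR : ∀ s a b, |r s a b| ≤ R) (ω : ℕ → S × Act × Act) :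
    -R ≤ limInfAvg r ω :=
  le_liminf_of_le (isBoundedUnder_le_avg hR ω).isCoboundedUnder_ge
    (Eventually.of_forall fun T => (abs_le.1 (abs_avg_le hR ω T)).1)

theorem limSupAvg_le (hR : ∀ s a b, |r s a b| ≤ R) (ω : ℕ → S × Act × Act) :
    limSupAvg r ω ≤ R :=
  limsup_le_of_le (isBoundedUnder_ge_avg hR ω).isCoboundedUnder_le
    (Eventually.of_forall fun T => (abs_le.1 (abs_avg_le hR ω T)).2)

theorem limInfAvg_le_limSupAvg (hR : ∀ s a b, |r s a b| ≤ R) (ω : ℕ → S × Act × Act) :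
    limInfAvg r ω ≤ limSupAvg r ω :=
  liminf_le_limsup (isBoundedUnder_le_avg hR ω) (isBoundedUnder_ge_avg hR ω)

theorem avg_neg (r : S → Act → Act → ℝ) (ω : ℕ → S × Act × Act) (T : ℕ) :
    avg (fun s a b => -r s a b) ω T = -avg r ω T := by
  simp [avg, neg_div]

end Average

variable [Fintype S] [Fintype Act]
variable [MeasurableSpace S] [DiscreteMeasurableSpace S]
variable [MeasurableSpace Act] [DiscreteMeasurableSpace Act]
variable {G : ConcurrentGame S Act} {r : S → Act → Act → ℝ} {σ : G.Strategy₁} {τ : G.Strategy₂}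
  {s : S} {v : ℝ} {h : S → ℝ}

instance : IsProbabilityMeasure (G.playMeasure σ τ s) :=
  have := PMF.toMeasure.isProbabilityMeasure (G.roundLaw σ τ [] s)
  inferInstanceAs (IsProbabilityMeasure (Kernel.trajMeasure (X := fun _ => S × Act × Act)
    (G.roundLaw σ τ [] s).toMeasure (G.nextKernel σ τ)))

theorem measurable_avg (r : S → Act → Act → ℝ) (T : ℕ) : Measurable fun ω => avg r ω T := by
  refine Measurable.div_const (Finset.measurable_fun_sum _ fun k _ => ?_) _
  exact (measurable_of_finite fun x : S × Act × Act => r x.1 x.2.1 x.2.2).comp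
    (measurable_pi_apply k)

theorem integrable_limInfAvg (r : S → Act → Act → ℝ) :
    Integrable (limInfAvg r) (G.playMeasure σ τ s) := by
  obtain ⟨R, -, hR⟩ := exists_abs_reward_le r
  refine Integrable.of_bound (Measurable.liminf (measurable_avg r)).aestronglyMeasurable R
    (ae_of_all _ fun ω => abs_le.2 ⟨neg_le_limInfAvg hR ω, ?_⟩)
  exact (limInfAvg_le_limSupAvg hR ω).trans (limSupAvg_le hR ω)

theorem integrable_limSupAvg (r : S → Act → Act → ℝ) :
    Integrable (limSupAvg r) (G.playMeasure σ τ s) := by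
  obtain ⟨R, -, hR⟩ := exists_abs_reward_le r
  refine Integrable.of_bound (Measurable.limsup (measurable_avg r)).aestronglyMeasurable R
    (ae_of_all _ fun ω => abs_le.2 ⟨?_, limSupAvg_le hR ω⟩)
  exact (neg_le_limInfAvg hR ω).trans (limInfAvg_le_limSupAvg hR ω)

theorem expLimInf_le_expLimSup (G : ConcurrentGame S Act) (r : S → Act → Act → ℝ)
    (σ : G.Strategy₁) (τ : G.Strategy₂) (s : S) :
    G.expLimInf r σ τ s ≤ G.expLimSup r σ τ s := by
  obtain ⟨R, -, hR⟩ := exists_abs_reward_le r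
  exact integral_mono (integrable_limInfAvg r) (integrable_limSupAvg r)
    fun ω => limInfAvg_le_limSupAvg hR ω

theorem le_expLimInf_of_ae {c : ℝ} (hc : ∀ᵐ ω ∂(G.playMeasure σ τ s), c ≤ limInfAvg r ω) :
    c ≤ G.expLimInf r σ τ s := by
  have := integral_mono_ae (integrable_const c) (integrable_limInfAvg r) hc
  simpa [expLimInf] using this

theorem expLimSup_le_of_ae {c : ℝ} (hc : ∀ᵐ ω ∂(G.playMeasure σ τ s), limSupAvg r ω ≤ c) :
    G.expLimSup r σ τ s ≤ c := by
  have := integral_mono_ae (integrable_limSupAvg r) (integrable_const c) hc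
  simpa [expLimSup] using this

omit [MeasurableSpace S] [DiscreteMeasurableSpace S] [MeasurableSpace Act]
  [DiscreteMeasurableSpace Act] in
theorem pmfMean_roundLaw (l : List (S × Act × Act)) (s : S) (f : S × Act × Act → ℝ) :
    pmfMean (G.roundLaw σ τ l s) f =
      pmfMean (σ.dist l s) fun a => pmfMean (τ.dist l s) fun b => f (s, a, b) := by
  simp only [roundLaw, pmfMean_bind, pmfMean_map]

open Topology in
theorem ae_tendsto_avg_sub_nextLaw (f : S × Act × Act → ℝ) :
    ∀ᵐ ω ∂(G.playMeasure σ τ s), Tendsto (fun T : ℕ => (∑ k ∈ Finset.range T,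
      (f (ω (k + 1)) - pmfMean (G.nextLaw σ τ k (Preorder.frestrictLe k ω)) f)) / T)
      atTop (𝓝 0) := by
  obtain ⟨C, hC⟩ := (Set.finite_range fun x => |f x|).bddAbove
  have := PMF.toMeasure.isProbabilityMeasure (G.roundLaw σ τ [] s)
  have key := ae_tendsto_avg_sub_condMean (G.roundLaw σ τ [] s).toMeasure (G.nextKernel σ τ)
    (measurable_of_finite f) fun x => hC ⟨x, rfl⟩
  filter_upwards [key] with ω hω
  convert hω using 6 with T k
  exact (integral_toMeasure_eq_pmfMean _ f).symm

-- The next state depends on the past only through the last state and moves, so the conditional mean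
-- involves `trans` alone and no strategy.
open Topology in
theorem ae_tendsto_avg_state (h : S → ℝ) :
    ∀ᵐ ω ∂(G.playMeasure σ τ s), Tendsto (fun T : ℕ => (∑ k ∈ Finset.range T,
      (h (ω (k + 1)).1 - pmfMean (G.trans (ω k).1 (ω k).2.1 (ω k).2.2) h)) / T)
      atTop (𝓝 0) := by
  filter_upwards [ae_tendsto_avg_sub_nextLaw (σ := σ) (τ := τ) (s := s) fun x => h x.1] with ω hω
  convert hω using 6 with T k
  simp [nextLaw, pmfMean_bind, pmfMean_roundLaw]

-- The surplus `f = r + E[h] - (v + h)` has nonnegative conditional mean. Summed along a play, `h`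
-- telescopes up to its deviations from conditional means, so the average of `r` is at least `v`
-- plus two vanishing averages of deviations and a boundary term of order 1/T.
open Topology in
theorem ae_exists_tendsto_le_avg
    (hD : ∀ l s, v + h s ≤ pmfMean (σ.dist l s) fun a => pmfMean (τ.dist l s) fun b =>
      r s a b + pmfMean (G.trans s a b) h) :
    ∀ᵐ ω ∂(G.playMeasure σ τ s), ∃ e : ℕ → ℝ, Tendsto e atTop (𝓝 v) ∧
      ∀ᶠ T in atTop, e T ≤ avg r ω T := by
  let f : S × Act × Act → ℝ := fun x =>
    r x.1 x.2.1 x.2.2 + pmfMean (G.trans x.1 x.2.1 x.2.2) h - (v + h x.1)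
  have hf : ∀ k x, 0 ≤ pmfMean (G.nextLaw σ τ k x) f := fun k x => by
    rw [nextLaw, pmfMean_bind]
    rw [← pmfMean_const (G.trans (x ⟨k, Finset.mem_Iic.2 le_rfl⟩).1
      (x ⟨k, Finset.mem_Iic.2 le_rfl⟩).2.1 (x ⟨k, Finset.mem_Iic.2 le_rfl⟩).2.2) 0]
    refine pmfMean_mono fun t => ?_
    rw [pmfMean_roundLaw]
    simp only [f, pmfMean_sub, pmfMean_const]
    exact sub_nonneg.2 (hD _ t)
  obtain ⟨C, hC⟩ := (Set.finite_range fun x => |f x|).bddAbove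
  obtain ⟨D, hD'⟩ := (Set.finite_range fun x => |h x|).bddAbove
  replace hC : ∀ x, |f x| ≤ C := fun x => hC ⟨x, rfl⟩
  replace hD' : ∀ x, |h x| ≤ D := fun x => hD' ⟨x, rfl⟩
  filter_upwards [ae_tendsto_avg_sub_nextLaw (σ := σ) (τ := τ) (s := s) f,
    ae_tendsto_avg_state (σ := σ) (τ := τ) (s := s) h] with ω h1 h2
  -- `2 * C` pays for replacing `f (ω (k + 1))` by `f (ω k)`, and `2 * D` for the telescoped `h`.
  have h3 : Tendsto (fun T : ℕ => (-(2 * C + 2 * D)) / (T : ℝ)) atTop (𝓝 0) :=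
    tendsto_const_nhds.div_atTop tendsto_natCast_atTop_atTop
  have hlim := ((h1.add h2).add h3).const_add v
  rw [add_zero, add_zero, add_zero] at hlim
  refine ⟨_, hlim, ?_⟩
  filter_upwards [eventually_ge_atTop 1] with T hT
  have hTpos : (0 : ℝ) < T := by exact_mod_cast hT
  rw [← add_div, ← add_div, avg, le_div_iff₀ hTpos, add_mul, div_mul_cancel₀ _ hTpos.ne']
  have e1 : ∑ k ∈ Finset.range T,
      (f (ω (k + 1)) - pmfMean (G.nextLaw σ τ k (Preorder.frestrictLe k ω)) f) ≤
      ∑ k ∈ Finset.range T, f (ω (k + 1)) :=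
    Finset.sum_le_sum fun k _ => by linarith [hf k (Preorder.frestrictLe k ω)]
  have e2 : ∑ k ∈ Finset.range T, f (ω (k + 1)) = ∑ k ∈ Finset.range T, f (ω k) +
      (f (ω T) - f (ω 0)) := by
    rw [← Finset.sum_range_sub (fun k => f (ω k)), ← Finset.sum_add_distrib]
    exact Finset.sum_congr rfl fun k _ => by ring
  have e3 : ∑ k ∈ Finset.range T, f (ω k) + ∑ k ∈ Finset.range T,
      (h (ω (k + 1)).1 - pmfMean (G.trans (ω k).1 (ω k).2.1 (ω k).2.2) h) =
      ∑ k ∈ Finset.range T, r (ω k).1 (ω k).2.1 (ω k).2.2 + (h (ω T).1 - h (ω 0).1) - T * v := by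
    have : (T : ℝ) * v = ∑ k ∈ Finset.range T, v := by simp
    rw [this, ← Finset.sum_range_sub (fun k => h (ω k).1), ← Finset.sum_add_distrib,
      ← Finset.sum_add_distrib, ← Finset.sum_sub_distrib]
    exact Finset.sum_congr rfl fun k _ => by simp only [f]; ring
  have b1 := abs_le.1 (hC (ω T))
  have b2 := abs_le.1 (hC (ω 0))
  have b3 := abs_le.1 (hD' (ω T).1)
  have b4 := abs_le.1 (hD' (ω 0).1)
  linarith [b1.2, b2.1, b3.2, b4.1]

theorem ae_le_limInfAvg
    (hD : ∀ l s, v + h s ≤ pmfMean (σ.dist l s) fun a => pmfMean (τ.dist l s) fun b =>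
      r s a b + pmfMean (G.trans s a b) h) :
    ∀ᵐ ω ∂(G.playMeasure σ τ s), v ≤ limInfAvg r ω := by
  obtain ⟨R, -, hR⟩ := exists_abs_reward_le r
  filter_upwards [ae_exists_tendsto_le_avg (s := s) hD] with ω ⟨e, he, hle⟩
  rw [← he.liminf_eq]
  exact liminf_le_liminf hle he.isBoundedUnder_ge (isBoundedUnder_le_avg hR ω).isCoboundedUnder_ge

theorem ae_limSupAvg_le
    (hD : ∀ l s, (pmfMean (σ.dist l s) fun a => pmfMean (τ.dist l s) fun b =>
      r s a b + pmfMean (G.trans s a b) h) ≤ v + h s) :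
    ∀ᵐ ω ∂(G.playMeasure σ τ s), limSupAvg r ω ≤ v := by
  obtain ⟨R, -, hR⟩ := exists_abs_reward_le r
  have neg : ∀ {α : Type} [Fintype α] (p : PMF α) (f : α → ℝ),
      pmfMean p (fun a => -f a) = -pmfMean p f := fun p f => by
    simpa using pmfMean_const_mul p (-1) f
  -- The lower bound is applied to the negated reward, potential and value.
  filter_upwards [ae_exists_tendsto_le_avg (s := s) (σ := σ) (τ := τ) (v := -v)
    (h := fun t => -h t) (r := fun s a b => -r s a b) fun l t => by
      simp only [neg, ← neg_add]
      exact neg_le_neg (hD l t)] with ω ⟨e, he, hle⟩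
  have he' : Tendsto (fun T => -e T) atTop (nhds v) := by simpa using he.neg
  rw [← he'.limsup_eq]
  refine limsup_le_limsup ?_ (isBoundedUnder_ge_avg hR ω).isCoboundedUnder_le
    he'.isBoundedUnder_le
  filter_upwards [hle] with T hT
  rw [avg_neg] at hT
  linarith

/-- A solution of the optimality equation gives an optimal strategy to Player 1 (maximizing) and to
Player 2 (minimizing). -/
theorem exists_optimal_of_isMatrixValue₁
    (H : ∀ s, IsMatrixValue (G.moves₁ s) (G.moves₂ s)
      (fun a b => r s a b + pmfMean (G.trans s a b) h) (v + h s)) :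
    ∃ (σ : G.Strategy₁) (τ : G.Strategy₂), (∀ τ' s, v ≤ G.expLimInf r σ τ' s) ∧
      ∀ σ' s, G.expLimSup r σ' τ s ≤ v := by
  choose p q hp hq hpv hqv using H
  refine ⟨.stationary p hp, .stationary q hq, fun τ' s => le_expLimInf_of_ae
    (ae_le_limInfAvg (h := h) fun l t => ?_), fun σ' s => expLimSup_le_of_ae
    (ae_limSupAvg_le (h := h) fun l t => ?_)⟩
  -- An optimal mixture is guaranteed against each pure reply; averaging over the opponent's reply,
  -- which may depend on the history, keeps the guarantee.
  · rw [pmfMean_comm]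
    conv_lhs => rw [← pmfMean_const (τ'.dist l t) (v + h t)]
    exact pmfMean_mono_of_support fun b hb => hpv t b (τ'.support_subset l t b hb)
  · conv_rhs => rw [← pmfMean_const (σ'.dist l t) (v + h t)]
    exact pmfMean_mono_of_support fun a ha => hqv t a (σ'.support_subset l t a ha)

/-- A solution of the optimality equation gives an optimal strategy to Player 2 (maximizing) and to
Player 1 (minimizing). -/
theorem exists_optimal_of_isMatrixValue₂
    (H : ∀ s, IsMatrixValue (G.moves₂ s) (G.moves₁ s)
      (fun b a => r s a b + pmfMean (G.trans s a b) h) (v + h s)) :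
    ∃ (τ : G.Strategy₂) (σ : G.Strategy₁), (∀ σ' s, v ≤ G.expLimInf r σ' τ s) ∧
      ∀ τ' s, G.expLimSup r σ τ' s ≤ v := by
  choose p q hp hq hpv hqv using H
  refine ⟨.stationary p hp, .stationary q hq, fun σ' s => le_expLimInf_of_ae
    (ae_le_limInfAvg (h := h) fun l t => ?_), fun τ' s => expLimSup_le_of_ae
    (ae_limSupAvg_le (h := h) fun l t => ?_)⟩
  · conv_lhs => rw [← pmfMean_const (σ'.dist l t) (v + h t)]
    exact pmfMean_mono_of_support fun a ha => hpv t a (σ'.support_subset l t a ha)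
  · rw [pmfMean_comm]
    conv_rhs => rw [← pmfMean_const (τ'.dist l t) (v + h t)]
    exact pmfMean_mono_of_support fun b hb => hqv t b (τ'.support_subset l t b hb)

theorem hasValue₁_of_optimal {σ : G.Strategy₁} {τ : G.Strategy₂}
    (hσ : ∀ τ' s, v ≤ G.expLimInf r σ τ' s) (hτ : ∀ σ' s, G.expLimSup r σ' τ s ≤ v) (s : S) :
    G.HasValue₁ r s v := by
  obtain ⟨R, -, hR⟩ := exists_abs_reward_le r
  exact iSup_iInf_eq_and_iInf_iSup_eq (R := R)
    (fun σ τ => le_expLimInf_of_ae (ae_of_all _ (neg_le_limInfAvg hR)))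
    (fun σ τ => expLimInf_le_expLimSup G r σ τ s)
    (fun σ τ => expLimSup_le_of_ae (ae_of_all _ (limSupAvg_le hR)))
    (fun τ' => hσ τ' s) (fun σ' => hτ σ' s)

theorem hasValue₂_of_optimal {σ : G.Strategy₁} {τ : G.Strategy₂}
    (hτ : ∀ σ' s, v ≤ G.expLimInf r σ' τ s) (hσ : ∀ τ' s, G.expLimSup r σ τ' s ≤ v) (s : S) :
    G.HasValue₂ r s v := by
  obtain ⟨R, -, hR⟩ := exists_abs_reward_le r
  exact iSup_iInf_eq_and_iInf_iSup_eq (R := R)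
    (f := fun τ σ => G.expLimInf r σ τ s) (g := fun τ σ => G.expLimSup r σ τ s)
    (fun τ σ => le_expLimInf_of_ae (ae_of_all _ (neg_le_limInfAvg hR)))
    (fun τ σ => expLimInf_le_expLimSup G r σ τ s)
    (fun τ σ => expLimSup_le_of_ae (ae_of_all _ (limSupAvg_le hR)))
    (fun σ' => hτ σ' s) (fun τ' => hσ τ' s)

-- After a last visit to `t`, every deviation of `g` from its conditional mean is at least the
-- increment of `g` plus 1. As `g ≥ 0`, the averaged deviations would stay above a sequence tending
-- to 1, while the law of large numbers sends them to 0.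
open Topology in
theorem IsLyapunov.ae_frequently_eq {t : S} {g : S → ℝ} (hg : G.IsLyapunov t g) :
    ∀ᵐ ω ∂(G.playMeasure σ τ s), ∃ᶠ k in atTop, (ω k).1 = t := by
  filter_upwards [ae_tendsto_avg_state (σ := σ) (τ := τ) (s := s) g] with ω hω
  by_contra hcon
  obtain ⟨K, hK⟩ := eventually_atTop.1 (not_frequently.1 hcon)
  set y : ℕ → ℝ := fun k =>
    g (ω (k + 1)).1 - pmfMean (G.trans (ω k).1 (ω k).2.1 (ω k).2.2) g
  let c : ℝ := ∑ k ∈ Finset.range K, y k - g (ω K).1 - K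
  have hc : ∀ T ≥ K, c + g (ω T).1 + T ≤ ∑ k ∈ Finset.range T, y k := by
    intro T hT
    induction T, hT using Nat.le_induction with
    | base => simp only [c]; linarith
    | succ T hT ih =>
      rw [Finset.sum_range_succ]
      have := hg.drift _ (hK T hT) (ω T).2.1 (ω T).2.2
      simp only [y] at ih ⊢
      push_cast
      linarith
  have hlim : Tendsto (fun T : ℕ => c / (T : ℝ) + 1) atTop (𝓝 1) := by
    simpa using (tendsto_const_nhds.div_atTop tendsto_natCast_atTop_atTop :
      Tendsto (fun T : ℕ => c / (T : ℝ)) atTop (𝓝 0)).add_const 1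
  have : (1 : ℝ) ≤ 0 := by
    refine le_of_tendsto_of_tendsto hlim hω ?_
    filter_upwards [eventually_ge_atTop K, eventually_ge_atTop 1] with T hT hT1
    have hTpos : (0 : ℝ) < T := by exact_mod_cast hT1
    rw [div_add_one hTpos.ne']
    gcongr
    linarith [hc T hT, hg.nonneg (ω T).1]
  linarith

end ConcurrentGame

/-! ### Ergodicity and symmetry of the block-withholding game -/

theorem one_sixth_le_changeLaw (best : Prop) [Decidable best] (c : SignType) :
    1 / 6 ≤ (changeLaw best c).toReal := by
  unfold changeLaw
  rw [PMF.ofFintype_apply]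
  split_ifs <;> norm_num

/-- `changeLaw` carries a `Decidable` instance, which blocks rewriting its proposition directly. -/
theorem changeLaw_congr {p q : Prop} [Decidable p] [Decidable q] (h : p ↔ q) :
    changeLaw p = changeLaw q := by
  obtain rfl : p = q := propext h
  congr

theorem pmfMean_bwGame_trans {n : ℕ} (s : PoolState n) (a b : Fin n) (f : PoolState n → ℝ) :
    pmfMean ((bwGame n).trans s a b) f =
      pmfMean (changeLaw (atMoves attrB s a b ≤ atMoves attrA s a b)) fun c =>
        pmfMean (changeLaw (atMoves attrA s a b ≤ atMoves attrB s a b)) fun d =>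
          f (resize s.1 c, resize s.2 d) := by
  simp only [bwGame, pmfMean_bind, pmfMean_map]

theorem exists_dist_resize {n : ℕ} (i t : Fin n) :
    ∃ c, Nat.dist (resize i c) t ≤ Nat.dist i t - 1 := by
  have hi := i.isLt
  have ht := t.isLt
  rcases lt_trichotomy (i : ℕ) t with h | h | h
  · refine ⟨.pos, ?_⟩
    simp only [resize, Nat.dist]
    omega
  · refine ⟨.zero, ?_⟩
    simp only [resize, Nat.dist]
    omega
  · refine ⟨.neg, ?_⟩
    simp only [resize, Nat.dist]
    omega

/-- The distance between two states: the least number of rounds for passing from one to the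
other. -/
def stateDist {n : ℕ} (s t : PoolState n) : ℕ := max (Nat.dist s.1 t.1) (Nat.dist s.2 t.2)

theorem stateDist_lt {n : ℕ} (s t : PoolState n) : stateDist s t < n := by
  have := s.1.isLt
  have := s.2.isLt
  have := t.1.isLt
  have := t.2.isLt
  simp only [stateDist, Nat.dist]
  omega

theorem stateDist_pos {n : ℕ} {s t : PoolState n} (h : s ≠ t) : 0 < stateDist s t := by
  by_contra hc
  apply h
  simp only [stateDist, Nat.dist] at hc
  ext <;> omega

/-- The base is 72 = 2 · 36: with probability at least 1/36 the exponent grows by at least 1, so the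
mean of `72 ^ (n - stateDist)` at least doubles, and the increase is at least 1. The other outcomes
are only bounded below by 0. -/
theorem isLyapunov_bwGame {n : ℕ} (t : PoolState n) :
    (bwGame n).IsLyapunov t fun s => 72 ^ n - 72 ^ (n - stateDist s t) where
  nonneg s := sub_nonneg.2 (pow_le_pow_right₀ (by norm_num) (Nat.sub_le _ _))
  target := by simp [stateDist]
  drift s hs a b := by
    rw [pmfMean_sub, pmfMean_const]
    obtain ⟨c, hc⟩ := exists_dist_resize s.1 t.1
    obtain ⟨d, hd⟩ := exists_dist_resize s.2 t.2
    have hpos := stateDist_pos hs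
    have hlt := stateDist_lt s t
    -- `hlt` excludes truncation of the natural subtraction.
    have hstep : n - stateDist s t + 1 ≤ n - stateDist (resize s.1 c, resize s.2 d) t := by
      simp only [stateDist] at hpos hlt ⊢
      omega
    have hpow : (72 : ℝ) ^ (n - stateDist s t) * 72 ≤
        72 ^ (n - stateDist (resize s.1 c, resize s.2 d) t) := by
      rw [← pow_succ]
      exact pow_le_pow_right₀ (by norm_num) hstep
    have h1 : (1 : ℝ) ≤ 72 ^ (n - stateDist s t) := one_le_pow₀ (by norm_num)
    have hf : ∀ x : PoolState n, (0 : ℝ) ≤ 72 ^ (n - stateDist x t) := fun x => by positivity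
    have h2 : 1 / 6 * (1 / 6 * (72 : ℝ) ^ (n - stateDist (resize s.1 c, resize s.2 d) t)) ≤
        pmfMean ((bwGame n).trans s a b) fun x => 72 ^ (n - stateDist x t) := by
      rw [pmfMean_bwGame_trans]
      refine le_trans ?_ (mul_le_pmfMean (fun c => ?_) c)
      · refine mul_le_mul (one_sixth_le_changeLaw _ c) ?_ (by positivity) ENNReal.toReal_nonneg
        refine le_trans ?_ (mul_le_pmfMean (fun d => hf _) d)
        exact mul_le_mul_of_nonneg_right (one_sixth_le_changeLaw _ d) (hf _)
      · simpa using pmfMean_mono (f := fun _ => 0) fun d => hf (resize s.1 c, resize s.2 d)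
    linarith

theorem attrA_swap (α β α' β' : ℝ) : attrA β α β' α' = attrB α β α' β' := by
  unfold attrA attrB
  congr 1
  ring

theorem attrB_swap (α β α' β' : ℝ) : attrB β α β' α' = attrA α β α' β' :=
  (attrA_swap β α β' α').symm

theorem rewardB_swap {n : ℕ} (s : PoolState n) (a b : Fin n) :
    rewardB s.swap b a = rewardA s a b := by
  simp only [rewardA, rewardB, atMoves, revA, revB, Prod.fst_swap, Prod.snd_swap, attrA_swap]

/-- In a tie both pools count as most attractive, so the rule is symmetric, and independence lets
the two changes be drawn in either order. -/
theorem pmfMean_bwGame_trans_swap {n : ℕ} (s : PoolState n) (a b : Fin n) (h : PoolState n → ℝ) :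
    pmfMean ((bwGame n).trans s.swap b a) (fun t => h t.swap) =
      pmfMean ((bwGame n).trans s a b) h := by
  rw [pmfMean_bwGame_trans, pmfMean_bwGame_trans, pmfMean_comm]
  have hA : atMoves attrA s.swap b a = atMoves attrB s a b := attrA_swap _ _ _ _
  have hB : atMoves attrB s.swap b a = atMoves attrA s a b := attrB_swap _ _ _ _
  rw [changeLaw_congr (p := atMoves attrA s.swap b a ≤ atMoves attrB s.swap b a)
      (q := atMoves attrB s a b ≤ atMoves attrA s a b) (by rw [hA, hB]),
    changeLaw_congr (p := atMoves attrB s.swap b a ≤ atMoves attrA s.swap b a)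
      (q := atMoves attrA s a b ≤ atMoves attrB s a b) (by rw [hA, hB])]
  rfl

theorem theorem1 (n : ℕ) (hn : 1 ≤ n) :
    (bwGame n).Ergodic ∧
    ∃ v : ℝ,
      (∀ s, (bwGame n).HasValue₁ rewardA s v) ∧
      (∀ s, (bwGame n).HasValue₂ rewardB s v) ∧
      ∃ τ : (bwGame n).Strategy₂, ∀ (σ : (bwGame n).Strategy₁) (s : PoolState n),
        v ≤ (bwGame n).expLimInf rewardB σ τ s := by
  refine ⟨fun s t σ τ => (isLyapunov_bwGame t).ae_frequently_eq, ?_⟩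
  -- The target state is arbitrary; `hn` only ensures that a state exists.
  obtain ⟨v, h, hA⟩ := (isLyapunov_bwGame (⟨0, hn⟩, ⟨0, hn⟩)).exists_bellman rewardA
  -- The equation of `B` at `s` is that of `A` at `s.swap`, with the same `v`.
  have hB : ∀ s, IsMatrixValue ((bwGame n).moves₂ s) ((bwGame n).moves₁ s)
      (fun b a => rewardB s a b + pmfMean ((bwGame n).trans s a b) fun t => h t.swap)
      (v + h s.swap) := fun s => by
    have key : (fun b a => rewardB s a b + pmfMean ((bwGame n).trans s a b) fun t => h t.swap) =
        fun b a => rewardA s.swap b a + pmfMean ((bwGame n).trans s.swap b a) h := by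
      funext b a
      have h1 := rewardB_swap s.swap b a
      have h2 := pmfMean_bwGame_trans_swap s.swap b a h
      rw [Prod.swap_swap] at h1 h2
      rw [h1, h2]
    rw [key]
    exact hA s.swap
  obtain ⟨σ, τ, hσ, hτ⟩ := ConcurrentGame.exists_optimal_of_isMatrixValue₁ hA
  obtain ⟨τ', σ', hτ', hσ'⟩ :=
    ConcurrentGame.exists_optimal_of_isMatrixValue₂ (h := fun s : PoolState n => h s.swap) hB
  exact ⟨v, ConcurrentGame.hasValue₁_of_optimal hσ hτ,
    ConcurrentGame.hasValue₂_of_optimal hτ' hσ', τ', hτ'⟩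

end
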